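/- Let $N\ge 1$, $\Omega_1=\{x\in\mathbb R^N: x_N>0\}$, $\Omega_2=\{x_N<0\}$, $\mathcal H=\{x_N=0\}$ (identified with $\mathbb R^{N-1}$ via $x'\mapsto(x',0)$), $e_N=(0,\dots,0,1)$ and $\lambda>0$. For $i=1,2$ let $A_i$ be a compact metric space and $b_i:\mathbb R^N\times A_i\to\mathbb R^N$, $l_i:\mathbb R^N\times A_i\to\mathbb R$. Assume: - [H0] $b_i$ is continuous and bounded, and there is $L_i$ with $|b_i(x,\alpha)-b_i(y,\alpha)|\le L_i|x-y|$ for all $x,y\in\mathbb R^N$, $\alpha\in A_i$; - [H1] $l_i$ is continuous and bounded; - [H2] for each $x\in\mathbb R^N$ the set $\{(b_i(x,\alpha),l_i(x,\alpha)):\alpha\in A_i\}$ is closed and convex, and there is $\delta>0$ such that $\overline{B(0,\delta)}\subset\{b_i(x,\alpha):\alpha\in A_i\}$ for $i=1,2$ and all $x\in\mathbb R^N$. Put $A=A_1\times A_2\times[0,1]$ and, for $a=(\alpha_1,\alpha_2,\mu)\in A$, $b_{\mathcal H}(x,a)=\mu b_1(x,\alpha_1)+(1-\mu)b_2(x,\alpha_2)$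 and $l_{\mathcal H}(x,a)=\mu l_1(x,\alpha_1)+(1-\mu)l_2(x,\alpha_2)$. Let $b(x,a)$ equal $b_1(x,\alpha_1)$ on $\Omega_1$, $b_2(x,\alpha_2)$ on $\Omega_2$ and $b_{\mathcal H}(x,a)$ on $\mathcal H$; let $\ell(x,a)$ equal $l_1(x,\alpha_1)$, $l_2(x,\alpha_2)$, $l_{\mathcal H}(x,a)$ respectively. Let $\mathcal T_{x_0}$ be the set of pairs $(X,a)$ with $X:[0,\infty)\to\mathbb R^N$ Lipschitz, $X(0)=x_0$, $a\in L^\infty(0,\infty;A)$ and $\dot X(t)=b(X(t),a(t))$ for a.e. $t>0$. Let $\mathcal T^{\rm reg}_{x_0}$ be the set of those $(X,a)\in\mathcal T_{x_0}$ such that $b_1(X(t),\alpha_1(t))\cdot e_N\le 0\le b_2(X(t),\alpha_2(t))\cdot e_N$ for a.e. $t>0$ with $X(t)\in\mathcal H$. Define $$\mathbf U^-(x_0)=\inf_{\mathcal T_{x_0}}\int_0^\infty \ell(X(t),a(t))e^{-\lambda t}\,dt,\qquad \mathbf U^+(x_0)=\inf_{\mathcal T^{\rm reg}_{x_0}}\int_0^\infty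 \ell(X(t),a(t))e^{-\lambda t}\,dt,$$ $$H_i(x,u,p)=\sup_{\alpha\in A_i}\{-b_i(x,\alpha)\cdot p+\lambda u-l_i(x,\alpha)\},$$ and, for $x\in\mathcal H$, $u\in\mathbb R$, $p'\in\mathbb R^{N-1}$, $$H_T(x,u,p')=\sup_{a\in A_0(x)}\{-b_{\mathcal H}(x,a)\cdot(p',0)+\lambda u-l_{\mathcal H}(x,a)\},$$ where $A_0(x)=\{a\in A: b_{\mathcal H}(x,a)\cdot e_N=0\}$. Let $H_T^{\rm reg}$ be the same supremum over $A_0^{\rm reg}(x)=\{a\in A_0(x): b_1(x,\alpha_1)\cdot e_N\le0\le b_2(x,\alpha_2)\cdot e_N\}$. Then $\mathbf U^-$ and $\mathbf U^+$ are both viscosity solutions of $$H_1(x,u,Du)=0\ \text{in }\Omega_1,\quad H_2(x,u,Du)=0\ \text{in }\Omega_2,\quad \min\{H_1,H_2\}(x,u,Du)\le0\ \text{and}\ \max\{H_1,H_2\}(x,u,Du)\ge 0\ \text{on }\mathcal H .$$ That is, each $u\in\{\mathbf U^-,\mathbf U^+\}$ is bounded, upper and lower semicontinuous, and for every $\phi\in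 C^1(\mathbb R^N)$: at each local maximum point $x$ of $u-\phi$ one has, with $H_i=H_i(x,u(x),D\phi(x))$, $H_1\le0$ if $x\in\Omega_1$, $H_2\le0$ if $x\in\Omega_2$, $\min\{H_1,H_2\}\le0$ if $x\in\mathcal H$; and at each local minimum point $x$ of $u-\phi$ one has $H_1\ge0$ if $x\in\Omega_1$, $H_2\ge0$ if $x\in\Omega_2$, $\max\{H_1,H_2\}\ge0$ if $x\in\mathcal H$. Moreover $x'\mapsto\mathbf U^-(x',0)$ is a viscosity subsolution on $\mathbb R^{N-1}$ of $H_T(x,u,D_{\mathcal H}u)=0$, and $x'\mapsto\mathbf U^+(x',0)$ is a viscosity subsolution on $\mathbb R^{N-1}$ of $H_T^{\rm reg}(x,u,D_{\mathcal H}u)=0$. That is, the function $w$ in question is bounded and upper semicontinuous, and for every $\phi\in C^1(\mathbb R^{N-1})$ and every local maximum point $x'$ of $w-\phi$ on $\mathbb R^{N-1}$ one has $H_T((x',0),w(x'),D\phi(x'))\le0$ (respectively $H_T^{\rm reg}((x',0),w(x'),D\phi(x'))\le0$). -/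

import Mathlib

open MeasureTheory Set

noncomputable section

namespace TwoDomain

/-- `ℝ^N` with `N = n + 1`; the last coordinate is `x_N`. -/
abbrev Space (n : ℕ) : Type := EuclideanSpace ℝ (Fin (n + 1))

/-- `ℝ^{N-1}`, identified with the hyperplane `x_N = 0` through `embed`. -/
abbrev Tangent (n : ℕ) : Type := EuclideanSpace ℝ (Fin n)

/-- The coordinate `x_N = x · e_N`. -/
def normalCoord {n : ℕ} (x : Space n) : ℝ := x (Fin.last n)

/-- The map `x' ↦ (x', 0)`. -/
def embed {n : ℕ} (x' : Tangent n) : Space n :=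
  WithLp.toLp 2 (Fin.snoc (α := fun _ => ℝ) (fun i => x' i) 0)

def upperHalf (n : ℕ) : Set (Space n) := {x | 0 < normalCoord x}

def lowerHalf (n : ℕ) : Set (Space n) := {x | normalCoord x < 0}

def hyperplane (n : ℕ) : Set (Space n) := {x | normalCoord x = 0}

/-- Dynamics `b` and running cost `l` with controls in `A`. -/
structure ControlSystem (n : ℕ) (A : Type*) where
  b : Space n → A → Space n
  l : Space n → A → ℝ

/-- `b` is continuous and bounded on `ℝ^N × A`, and Lipschitz in `x` uniformly in the control. -/
structure DynamicsRegular {n : ℕ} {A : Type*} [TopologicalSpace A]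
    (S : ControlSystem n A) : Prop where
  continuous : Continuous (fun q : Space n × A => S.b q.1 q.2)
  bounded : ∃ C : ℝ, ∀ x α, ‖S.b x α‖ ≤ C
  lipschitz : ∃ L : ℝ, ∀ x y α, ‖S.b x α - S.b y α‖ ≤ L * ‖x - y‖

/-- `l` is continuous and bounded on `ℝ^N × A`. -/
structure CostRegular {n : ℕ} {A : Type*} [TopologicalSpace A]
    (S : ControlSystem n A) : Prop where
  continuous : Continuous (fun q : Space n × A => S.l q.1 q.2)
  bounded : ∃ C : ℝ, ∀ x α, |S.l x α| ≤ C

/-- For each `x`, the set `{(b(x,α), l(x,α)) : α ∈ A}` is closed and convex. -/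
def ClosedConvexImages {n : ℕ} {A : Type*} (S : ControlSystem n A) : Prop :=
  ∀ x, IsClosed (range fun α => (S.b x α, S.l x α)) ∧
    Convex ℝ (range fun α => (S.b x α, S.l x α))

/-- The closed ball of radius `δ` is contained in `{b(x,α) : α ∈ A}` for every `x`. -/
def Controllable {n : ℕ} {A : Type*} (S : ControlSystem n A) (δ : ℝ) : Prop :=
  ∀ x, Metric.closedBall (0 : Space n) δ ⊆ range (S.b x)

variable {n : ℕ} {A₁ A₂ : Type*}

/-- `b_H(x, (α₁, α₂, μ)) = μ b₁(x, α₁) + (1 - μ) b₂(x, α₂)`. -/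
def mixedDynamics (S₁ : ControlSystem n A₁) (S₂ : ControlSystem n A₂)
    (x : Space n) (a : A₁ × A₂ × unitInterval) : Space n :=
  (a.2.2 : ℝ) • S₁.b x a.1 + (1 - (a.2.2 : ℝ)) • S₂.b x a.2.1

/-- `l_H(x, (α₁, α₂, μ)) = μ l₁(x, α₁) + (1 - μ) l₂(x, α₂)`. -/
def mixedCost (S₁ : ControlSystem n A₁) (S₂ : ControlSystem n A₂)
    (x : Space n) (a : A₁ × A₂ × unitInterval) : ℝ :=
  (a.2.2 : ℝ) * S₁.l x a.1 + (1 - (a.2.2 : ℝ)) * S₂.l x a.2.1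

open Classical in
/-- `b₁` in the upper half-space, `b₂` in the lower one, `b_H` on the hyperplane. -/
def globalDynamics (S₁ : ControlSystem n A₁) (S₂ : ControlSystem n A₂)
    (x : Space n) (a : A₁ × A₂ × unitInterval) : Space n :=
  if x ∈ upperHalf n then S₁.b x a.1
  else if x ∈ lowerHalf n then S₂.b x a.2.1
  else mixedDynamics S₁ S₂ x a

open Classical in
/-- `l₁` in the upper half-space, `l₂` in the lower one, `l_H` on the hyperplane. -/
def globalCost (S₁ : ControlSystem n A₁) (S₂ : ControlSystem n A₂)
    (x : Space n) (a : A₁ × A₂ × unitInterval) : ℝ :=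
  if x ∈ upperHalf n then S₁.l x a.1
  else if x ∈ lowerHalf n then S₂.l x a.2.1
  else mixedCost S₁ S₂ x a

/-- `b₁(x, α₁) · e_N ≤ 0` and `b₂(x, α₂) · e_N ≥ 0`. -/
def IsRegularControl (S₁ : ControlSystem n A₁) (S₂ : ControlSystem n A₂)
    (x : Space n) (a : A₁ × A₂ × unitInterval) : Prop :=
  normalCoord (S₁.b x a.1) ≤ 0 ∧ 0 ≤ normalCoord (S₂.b x a.2.1)

/-- Admissible controlled trajectories from `x₀`: `X` is Lipschitz on `[0, ∞)`, the control is a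
measurable map into the compact space `A₁ × A₂ × [0, 1]`, and the equation holds a.e.
(Only the values at nonnegative times matter.) -/
structure IsTrajectory [TopologicalSpace A₁] [TopologicalSpace A₂]
    (S₁ : ControlSystem n A₁) (S₂ : ControlSystem n A₂) (x₀ : Space n)
    (X : ℝ → Space n) (a : ℝ → A₁ × A₂ × unitInterval) : Prop where
  lipschitz : ∃ K, LipschitzOnWith K X (Ici 0)
  initial : X 0 = x₀
  control_measurable : AEStronglyMeasurable a (volume.restrict (Ioi 0))
  deriv_eq : ∀ᵐ t ∂(volume.restrict (Ioi (0 : ℝ))),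
    HasDerivAt X (globalDynamics S₁ S₂ (X t) (a t)) t

/-- Controlled trajectories whose dynamics is regular a.e. while on the hyperplane. -/
structure IsRegularTrajectory [TopologicalSpace A₁] [TopologicalSpace A₂]
    (S₁ : ControlSystem n A₁) (S₂ : ControlSystem n A₂) (x₀ : Space n)
    (X : ℝ → Space n) (a : ℝ → A₁ × A₂ × unitInterval) : Prop
    extends IsTrajectory S₁ S₂ x₀ X a where
  regular : ∀ᵐ t ∂(volume.restrict (Ioi (0 : ℝ))),
    X t ∈ hyperplane n → IsRegularControl S₁ S₂ (X t) (a t)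

/-- The discounted infinite horizon cost. -/
def cost (S₁ : ControlSystem n A₁) (S₂ : ControlSystem n A₂) (lam : ℝ)
    (X : ℝ → Space n) (a : ℝ → A₁ × A₂ × unitInterval) : ℝ :=
  ∫ t in Ioi (0 : ℝ), globalCost S₁ S₂ (X t) (a t) * Real.exp (-lam * t)

/-- `U⁻`: infimum of the cost over all controlled trajectories. -/
def valueMinus [TopologicalSpace A₁] [TopologicalSpace A₂]
    (S₁ : ControlSystem n A₁) (S₂ : ControlSystem n A₂) (lam : ℝ) (x₀ : Space n) : ℝ :=
  sInf {J | ∃ X a, IsTrajectory S₁ S₂ x₀ X a ∧ J = cost S₁ S₂ lam X a}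

/-- `U⁺`: infimum of the cost over regular controlled trajectories. -/
def valuePlus [TopologicalSpace A₁] [TopologicalSpace A₂]
    (S₁ : ControlSystem n A₁) (S₂ : ControlSystem n A₂) (lam : ℝ) (x₀ : Space n) : ℝ :=
  sInf {J | ∃ X a, IsRegularTrajectory S₁ S₂ x₀ X a ∧ J = cost S₁ S₂ lam X a}

/-- `H_i(x, u, p) = sup_α { -b_i(x,α) · p + λ u - l_i(x,α) }`. -/
def hamiltonian {A : Type*} (S : ControlSystem n A) (lam : ℝ)
    (x : Space n) (u : ℝ) (p : Space n) : ℝ :=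
  ⨆ α : A, (-(inner ℝ (S.b x α) p) + lam * u - S.l x α)

/-- `A_0(x)`: controls with `b_H(x, a) · e_N = 0`. -/
def tangentialControls (S₁ : ControlSystem n A₁) (S₂ : ControlSystem n A₂) (x : Space n) :
    Set (A₁ × A₂ × unitInterval) :=
  {a | normalCoord (mixedDynamics S₁ S₂ x a) = 0}

/-- `A_0^reg(x)`: the regular elements of `A_0(x)`. -/
def regularTangentialControls (S₁ : ControlSystem n A₁) (S₂ : ControlSystem n A₂)
    (x : Space n) : Set (A₁ × A₂ × unitInterval) :=
  {a | a ∈ tangentialControls S₁ S₂ x ∧ IsRegularControl S₁ S₂ x a}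

/-- The tangential Hamiltonian `H_T` at the point `(x', 0)`. -/
def tangentialHamiltonian (S₁ : ControlSystem n A₁) (S₂ : ControlSystem n A₂) (lam : ℝ)
    (x' : Tangent n) (u : ℝ) (p' : Tangent n) : ℝ :=
  ⨆ a : tangentialControls S₁ S₂ (embed x'),
    (-(inner ℝ (mixedDynamics S₁ S₂ (embed x') a) (embed p')) + lam * u
      - mixedCost S₁ S₂ (embed x') a)

/-- The regular tangential Hamiltonian `H_T^reg` at the point `(x', 0)`. -/
def regularTangentialHamiltonian (S₁ : ControlSystem n A₁) (S₂ : ControlSystem n A₂) (lam : ℝ)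
    (x' : Tangent n) (u : ℝ) (p' : Tangent n) : ℝ :=
  ⨆ a : regularTangentialControls S₁ S₂ (embed x'),
    (-(inner ℝ (mixedDynamics S₁ S₂ (embed x') a) (embed p')) + lam * u
      - mixedCost S₁ S₂ (embed x') a)

/-- `u` is a bounded usc viscosity subsolution of `F₁ = 0` in `x_N > 0`, `F₂ = 0` in `x_N < 0`,
with `min(F₁, F₂) ≤ 0` on `x_N = 0`. -/
structure IsViscositySubsolution (F₁ F₂ : Space n → ℝ → Space n → ℝ)
    (u : Space n → ℝ) : Prop where
  bounded : ∃ C : ℝ, ∀ x, |u x| ≤ C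
  usc : UpperSemicontinuous u
  upper : ∀ φ : Space n → ℝ, ContDiff ℝ 1 φ → ∀ x ∈ upperHalf n,
    IsLocalMax (fun y => u y - φ y) x → F₁ x (u x) (gradient φ x) ≤ 0
  lower : ∀ φ : Space n → ℝ, ContDiff ℝ 1 φ → ∀ x ∈ lowerHalf n,
    IsLocalMax (fun y => u y - φ y) x → F₂ x (u x) (gradient φ x) ≤ 0
  interface : ∀ φ : Space n → ℝ, ContDiff ℝ 1 φ → ∀ x ∈ hyperplane n,
    IsLocalMax (fun y => u y - φ y) x →
      min (F₁ x (u x) (gradient φ x)) (F₂ x (u x) (gradient φ x)) ≤ 0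

/-- `u` is a bounded lsc viscosity supersolution of `F₁ = 0` in `x_N > 0`, `F₂ = 0` in `x_N < 0`,
with `max(F₁, F₂) ≥ 0` on `x_N = 0`. -/
structure IsViscositySupersolution (F₁ F₂ : Space n → ℝ → Space n → ℝ)
    (u : Space n → ℝ) : Prop where
  bounded : ∃ C : ℝ, ∀ x, |u x| ≤ C
  lsc : LowerSemicontinuous u
  upper : ∀ φ : Space n → ℝ, ContDiff ℝ 1 φ → ∀ x ∈ upperHalf n,
    IsLocalMin (fun y => u y - φ y) x → 0 ≤ F₁ x (u x) (gradient φ x)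
  lower : ∀ φ : Space n → ℝ, ContDiff ℝ 1 φ → ∀ x ∈ lowerHalf n,
    IsLocalMin (fun y => u y - φ y) x → 0 ≤ F₂ x (u x) (gradient φ x)
  interface : ∀ φ : Space n → ℝ, ContDiff ℝ 1 φ → ∀ x ∈ hyperplane n,
    IsLocalMin (fun y => u y - φ y) x →
      0 ≤ max (F₁ x (u x) (gradient φ x)) (F₂ x (u x) (gradient φ x))

def IsViscositySolution (F₁ F₂ : Space n → ℝ → Space n → ℝ) (u : Space n → ℝ) : Prop :=
  IsViscositySubsolution F₁ F₂ u ∧ IsViscositySupersolution F₁ F₂ u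

/-- `u` is a bounded usc viscosity subsolution of `F = 0` on `ℝ^{N-1}`: maxima are taken
relatively to the hyperplane. -/
structure IsTangentialSubsolution (F : Tangent n → ℝ → Tangent n → ℝ)
    (u : Tangent n → ℝ) : Prop where
  bounded : ∃ C : ℝ, ∀ x', |u x'| ≤ C
  usc : UpperSemicontinuous u
  subsolution : ∀ φ : Tangent n → ℝ, ContDiff ℝ 1 φ → ∀ x' : Tangent n,
    IsLocalMax (fun y => u y - φ y) x' → F x' (u x') (gradient φ x') ≤ 0

end TwoDomain

end

/-! Both values are infima over trajectories whose control obeys a constraint `P` while on the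
hyperplane: `P` is trivial for `U⁻` and is `IsRegularControl` for `U⁺`. The proof treats all such
`P` at once, asking only that regular controls satisfy `P`.

No differential equation is ever solved: every trajectory that has to be constructed starts with a
straight segment. By convexity and controllability, the velocity `(1 - ε) • b(x, α)` is available at
every point near `x`, at a cost exceeding `l(x, α)` by `O(ε)` (`eventually_exists_control`), and
measurable selection turns this into a control along a short segment. With dynamic programming
(`constrainedValue_le_segment`), short times and then `ε → 0` give the subsolution inequality for
each control whose segment is admissible. Segments of speed `δ` also make the value Lipschitz.

On the interface, suppose both Hamiltonians are positive, witnessed by `α₁` and `α₂`. If one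
velocity points strictly into its own half-space, moving inside that half-space contradicts
positivity. Otherwise `b₁ · e_N ≤ 0 ≤ b₂ · e_N`, so some mixture is tangential and regular, hence
allowed by every `P`. The same mixture argument along the hyperplane gives the tangential
inequalities.

For supersolutions (`StandingAssumptions.not_isLocalMin`), if the relevant Hamiltonians were
negative at a minimum of `u - φ`, every trajectory would lose a fixed amount over a fixed time,
contradicting the existence of nearly optimal ones. On the hyperplane this uses that mixed data are
convex combinations of the two systems. -/

noncomputable section

namespace TwoDomain

/-! ### Measurable selection of controls -/

/-- A closed relation with nonempty sections in a compact metric space has a measurable selection. -/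
theorem exists_measurable_selection {A : Type*} [MetricSpace A] [CompactSpace A]
    {R : Set (ℝ × A)} (hR : IsClosed R) (hne : ∀ t, ∃ a, (t, a) ∈ R) :
    ∃ α : ℝ → A, StronglyMeasurable α ∧ ∀ t, (t, α t) ∈ R := by
  have : Nonempty A := ⟨(hne 0).choose⟩
  -- Parametrizing `A` by the Cantor set brings in the order of `ℝ`: each section is compact, so it
  -- has a least parameter, which is a canonical choice.
  obtain ⟨g, hgc, hgs⟩ := exists_nat_bool_continuous_surjective_of_compact A
  let f : cantorSet → A := g ∘ cantorSetHomeomorphNatToBool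
  have hfc : Continuous f := hgc.comp cantorSetHomeomorphNatToBool.continuous
  have hfs : Function.Surjective f := hgs.comp cantorSetHomeomorphNatToBool.surjective
  have : CompactSpace cantorSet := isCompact_iff_compactSpace.mp isCompact_cantorSet
  let K : ℝ → Set cantorSet := fun t => {r | (t, f r) ∈ R}
  have hKc : ∀ t, IsClosed (K t) := fun t =>
    hR.preimage (continuous_const.prodMk hfc)
  have hKne : ∀ t, (K t).Nonempty := fun t => by
    obtain ⟨a, ha⟩ := hne t
    obtain ⟨r, rfl⟩ := hfs a
    exact ⟨r, ha⟩
  have hmin : ∀ t, ∃ r ∈ K t, ∀ s ∈ K t, (r : ℝ) ≤ s := fun t => by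
    obtain ⟨r, hr, h⟩ := (hKc t).isCompact.exists_isMinOn (hKne t)
      (continuous_subtype_val (p := fun r => r ∈ cantorSet)).continuousOn
    exact ⟨r, hr, fun s hs => h hs⟩
  choose c hcK hcmin using hmin
  have hcm : Measurable c := by
    -- The sublevel sets of the least parameter are projections of closed sets along a compact
    -- factor, hence closed.
    refine Measurable.subtype_mk (f := fun t => (c t : ℝ)) (measurable_of_Iic fun q => ?_) (h := fun t => (c t).2)
    have : (fun t => (c t : ℝ)) ⁻¹' Iic q
        = Prod.fst '' {p : ℝ × cantorSet | (p.1, f p.2) ∈ R ∧ (p.2 : ℝ) ≤ q} := by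
      ext t
      constructor
      · intro h
        exact ⟨(t, c t), ⟨hcK t, h⟩, rfl⟩
      · rintro ⟨⟨t', r⟩, ⟨h1, h2⟩, rfl⟩
        exact (hcmin t' r h1).trans h2
    rw [this]
    refine (isClosedMap_fst_of_compactSpace _ (IsClosed.inter ?_ ?_)).measurableSet
    · exact hR.preimage (continuous_fst.prodMk (hfc.comp continuous_snd))
    · exact isClosed_le (continuous_subtype_val.comp continuous_snd) continuous_const
  exact ⟨f ∘ c, hfc.comp_stronglyMeasurable hcm.stronglyMeasurable, hcK⟩

theorem continuous_normalCoord {n : ℕ} : Continuous (normalCoord (n := n)) := by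
  unfold normalCoord; fun_prop

theorem normalCoord_add {n : ℕ} (x y : Space n) :
    normalCoord (x + y) = normalCoord x + normalCoord y := rfl

theorem normalCoord_smul {n : ℕ} (c : ℝ) (x : Space n) :
    normalCoord (c • x) = c * normalCoord x := rfl

/-- Measurable control keeping a prescribed velocity along a segment, at a prescribed cost. -/
theorem exists_control_on_segment {n : ℕ} {A : Type*} [MetricSpace A] [CompactSpace A]
    {S : ControlSystem n A} (hb : DynamicsRegular S) (hl : CostRegular S)
    {x v w : Space n} {m τ : ℝ} (hτ : 0 ≤ τ)
    (h : ∀ t ∈ Icc 0 τ, ∃ α, S.b (x + t • v) α = w ∧ S.l (x + t • v) α ≤ m) :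
    ∃ α : ℝ → A, StronglyMeasurable α ∧
      ∀ t ∈ Icc 0 τ, S.b (x + t • v) (α t) = w ∧ S.l (x + t • v) (α t) ≤ m := by
  -- Clamping time to `[0, τ]` makes the relation closed with nonempty sections over the whole line.
  let q : ℝ → ℝ := fun t => projIcc 0 τ hτ t
  have hq : Continuous q := continuous_subtype_val.comp continuous_projIcc
  let R : Set (ℝ × A) := {p | S.b (x + q p.1 • v) p.2 = w ∧ S.l (x + q p.1 • v) p.2 ≤ m}
  have hpath : Continuous fun p : ℝ × A => (x + q p.1 • v, p.2) := by fun_prop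
  have hR : IsClosed R :=
    (isClosed_eq (hb.continuous.comp hpath) continuous_const).inter
      (isClosed_le (hl.continuous.comp hpath) continuous_const)
  obtain ⟨α, hα, hαR⟩ := exists_measurable_selection hR fun t => h _ (projIcc 0 τ hτ t).2
  refine ⟨α, hα, fun t ht => ?_⟩
  have := hαR t
  simpa [R, q, projIcc_of_mem hτ ht] using this

variable {n : ℕ} {A₁ A₂ : Type*}

/-! ### Uniform bounds on the data -/

/-- Bounds on the dynamics and running cost, uniform in state and control. -/
structure UniformBound {A : Type*} (S : ControlSystem n A) (C : ℝ) : Prop where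
  b : ∀ x α, ‖S.b x α‖ ≤ C
  l : ∀ x α, |S.l x α| ≤ C

theorem UniformBound.mono {A : Type*} {S : ControlSystem n A} {C D : ℝ} (h : UniformBound S C)
    (hCD : C ≤ D) : UniformBound S D :=
  ⟨fun x α => (h.b x α).trans hCD, fun x α => (h.l x α).trans hCD⟩

theorem exists_uniformBound {A : Type*} [TopologicalSpace A] {S : ControlSystem n A}
    (hb : DynamicsRegular S) (hl : CostRegular S) : ∃ C, UniformBound S C := by
  obtain ⟨C, hC⟩ := hb.bounded
  obtain ⟨D, hD⟩ := hl.bounded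
  exact ⟨max C D, fun x α => (hC x α).trans (le_max_left _ _),
    fun x α => (hD x α).trans (le_max_right _ _)⟩

theorem norm_mixedDynamics_le {S₁ : ControlSystem n A₁} {S₂ : ControlSystem n A₂} {C : ℝ}
    (h₁ : UniformBound S₁ C) (h₂ : UniformBound S₂ C) (x : Space n) (a : A₁ × A₂ × unitInterval) :
    ‖mixedDynamics S₁ S₂ x a‖ ≤ C := by
  have h0 := a.2.2.2.1
  have h1 := a.2.2.2.2
  unfold mixedDynamics
  refine (norm_add_le _ _).trans ?_
  rw [norm_smul, norm_smul, Real.norm_of_nonneg h0, Real.norm_of_nonneg (sub_nonneg.2 h1)]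
  nlinarith [h₁.b x a.1, h₂.b x a.2.1, sub_nonneg.2 h1]

theorem abs_mixedCost_le {S₁ : ControlSystem n A₁} {S₂ : ControlSystem n A₂} {C : ℝ}
    (h₁ : UniformBound S₁ C) (h₂ : UniformBound S₂ C) (x : Space n) (a : A₁ × A₂ × unitInterval) :
    |mixedCost S₁ S₂ x a| ≤ C := by
  have h0 := a.2.2.2.1
  have h1 := a.2.2.2.2
  have e1 := abs_le.1 (h₁.l x a.1)
  have e2 := abs_le.1 (h₂.l x a.2.1)
  unfold mixedCost
  rw [abs_le]
  constructor <;> nlinarith [sub_nonneg.2 h1]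

theorem norm_globalDynamics_le {S₁ : ControlSystem n A₁} {S₂ : ControlSystem n A₂} {C : ℝ}
    (h₁ : UniformBound S₁ C) (h₂ : UniformBound S₂ C) (x : Space n) (a : A₁ × A₂ × unitInterval) :
    ‖globalDynamics S₁ S₂ x a‖ ≤ C := by
  unfold globalDynamics
  split_ifs
  exacts [h₁.b _ _, h₂.b _ _, norm_mixedDynamics_le h₁ h₂ _ _]

theorem abs_globalCost_le {S₁ : ControlSystem n A₁} {S₂ : ControlSystem n A₂} {C : ℝ}
    (h₁ : UniformBound S₁ C) (h₂ : UniformBound S₂ C) (x : Space n) (a : A₁ × A₂ × unitInterval) :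
    |globalCost S₁ S₂ x a| ≤ C := by
  unfold globalCost
  split_ifs
  exacts [h₁.l _ _, h₂.l _ _, abs_mixedCost_le h₁ h₂ _ _]

/-! ### Trajectories, discounted cost and dynamic programming -/

section Trajectories

variable [MetricSpace A₁] [MetricSpace A₂]
  {S₁ : ControlSystem n A₁} {S₂ : ControlSystem n A₂} {lam C : ℝ}
  {x₀ : Space n} {X : ℝ → Space n} {a : ℝ → A₁ × A₂ × unitInterval}

theorem IsTrajectory.aestronglyMeasurable_cost (hl₁ : CostRegular S₁) (hl₂ : CostRegular S₂)
    (h : IsTrajectory S₁ S₂ x₀ X a) :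
    AEStronglyMeasurable (fun t => globalCost S₁ S₂ (X t) (a t)) (volume.restrict (Ioi 0)) := by
  classical
  obtain ⟨K, hK⟩ := h.lipschitz
  -- Freezing `X` at negative times gives a continuous path on `ℝ`, so the sets of times spent in
  -- each half-space are measurable.
  let Y : ℝ → Space n := fun t => X (max t 0)
  have hY : Continuous Y := by
    rw [← continuousOn_univ]
    exact hK.continuousOn.comp (by fun_prop) fun t _ => le_max_right t 0
  have hYX : ∀ t ∈ Ioi (0 : ℝ), Y t = X t := fun t ht => by simp [Y, max_eq_left (mem_Ioi.1 ht).le]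
  have ha := h.control_measurable
  have hYm : AEStronglyMeasurable Y (volume.restrict (Ioi 0)) := hY.aestronglyMeasurable
  have e1 : AEStronglyMeasurable (fun t => S₁.l (Y t) (a t).1) (volume.restrict (Ioi 0)) :=
    hl₁.continuous.comp_aestronglyMeasurable
      (hYm.prodMk (continuous_fst.comp_aestronglyMeasurable ha))
  have e2 : AEStronglyMeasurable (fun t => S₂.l (Y t) (a t).2.1) (volume.restrict (Ioi 0)) :=
    hl₂.continuous.comp_aestronglyMeasurable
      (hYm.prodMk ((continuous_fst.comp continuous_snd).comp_aestronglyMeasurable ha))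
  have eμ : AEStronglyMeasurable (fun t => ((a t).2.2 : ℝ)) (volume.restrict (Ioi 0)) :=
    (continuous_subtype_val.comp (continuous_snd.comp continuous_snd)).comp_aestronglyMeasurable ha
  have e3 : AEStronglyMeasurable (fun t => mixedCost S₁ S₂ (Y t) (a t)) (volume.restrict (Ioi 0)) :=
    (eμ.mul e1).add ((aestronglyMeasurable_const.sub eμ).mul e2)
  have m1 : MeasurableSet {t | Y t ∈ upperHalf n} :=
    (isOpen_lt continuous_const (continuous_normalCoord.comp hY)).measurableSet
  have m2 : MeasurableSet {t | Y t ∈ lowerHalf n} :=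
    (isOpen_lt (continuous_normalCoord.comp hY) continuous_const).measurableSet
  have key := AEStronglyMeasurable.piecewise m1 e1.restrict
    (AEStronglyMeasurable.piecewise m2 e2.restrict e3.restrict).restrict
  refine key.congr ?_
  filter_upwards [self_mem_ae_restrict measurableSet_Ioi] with t ht
  simp only [Set.piecewise, mem_ofPred_eq, globalCost, hYX t ht]

theorem integrableOn_exp_discount (hlam : 0 < lam) (c : ℝ) :
    IntegrableOn (fun t => Real.exp (-lam * t)) (Ioi c) :=
  integrableOn_exp_mul_Ioi (neg_lt_zero.2 hlam) c

theorem IsTrajectory.integrableOn_cost (hlam : 0 < lam)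
    (hl₁ : CostRegular S₁) (hl₂ : CostRegular S₂) (h₁ : UniformBound S₁ C) (h₂ : UniformBound S₂ C)
    (h : IsTrajectory S₁ S₂ x₀ X a) :
    IntegrableOn (fun t => globalCost S₁ S₂ (X t) (a t) * Real.exp (-lam * t)) (Ioi 0) := by
  refine Integrable.bdd_mul (c := C) (integrableOn_exp_discount hlam 0)
    (h.aestronglyMeasurable_cost hl₁ hl₂) ?_
  exact Filter.Eventually.of_forall fun t => abs_globalCost_le h₁ h₂ _ _

omit [MetricSpace A₁] [MetricSpace A₂] in
theorem abs_cost_le (hlam : 0 < lam) (h₁ : UniformBound S₁ C) (h₂ : UniformBound S₂ C)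
    (X : ℝ → Space n) (a : ℝ → A₁ × A₂ × unitInterval) : |cost S₁ S₂ lam X a| ≤ C / lam := by
  have hi : IntegrableOn (fun t => C * Real.exp (-lam * t)) (Ioi 0) :=
    (integrableOn_exp_discount hlam 0).const_mul C
  have := norm_integral_le_of_norm_le hi (f := fun t => globalCost S₁ S₂ (X t) (a t) * Real.exp (-lam * t))
    (Filter.Eventually.of_forall fun t => by
      rw [norm_mul, Real.norm_of_nonneg (Real.exp_pos _).le]
      exact mul_le_mul_of_nonneg_right (abs_globalCost_le h₁ h₂ _ _) (Real.exp_pos _).le)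
  refine this.trans (le_of_eq ?_)
  rw [integral_const_mul, integral_exp_mul_Ioi (neg_lt_zero.2 hlam)]
  simp
  field_simp

theorem ae_restrict_Ioi_comp_add {p : ℝ → Prop} {τ : ℝ} (hτ : 0 ≤ τ)
    (h : ∀ᵐ t ∂(volume.restrict (Ioi (0 : ℝ))), p t) :
    ∀ᵐ t ∂(volume.restrict (Ioi (0 : ℝ))), p (t + τ) := by
  rw [ae_restrict_iff' measurableSet_Ioi] at h ⊢
  have := (measurePreserving_add_right volume τ).quasiMeasurePreserving.ae h
  filter_upwards [this] with t ht h0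
  exact ht (by simp only [mem_Ioi] at *; linarith)

theorem integral_Ioi_comp_add (f : ℝ → ℝ) (τ : ℝ) :
    ∫ t in Ioi τ, f t = ∫ t in Ioi 0, f (t + τ) := by
  have := (measurePreserving_add_right volume τ).setIntegral_preimage_emb
    (measurableEmbedding_addRight τ) f (Ioi τ)
  rw [← this]
  congr 2
  ext t; simp

theorem aestronglyMeasurable_comp_add {E : Type*} [TopologicalSpace E] {f : ℝ → E} {s : Set ℝ}
    (hs : MeasurableSet s) {τ : ℝ} (hf : AEStronglyMeasurable f (volume.restrict s)) :
    AEStronglyMeasurable (fun t => f (t + τ)) (volume.restrict ((· + τ) ⁻¹' s)) :=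
  hf.comp_quasiMeasurePreserving
    ((measurePreserving_add_right volume τ).restrict_preimage hs).quasiMeasurePreserving

theorem IsTrajectory.shift {τ : ℝ} (hτ : 0 ≤ τ) (h : IsTrajectory S₁ S₂ x₀ X a) :
    IsTrajectory S₁ S₂ (X τ) (fun t => X (t + τ)) (fun t => a (t + τ)) where
  lipschitz := by
    obtain ⟨K, hK⟩ := h.lipschitz
    refine ⟨K, LipschitzOnWith.of_dist_le_mul fun s hs t ht => ?_⟩
    simpa using hK.dist_le_mul (s + τ) (add_nonneg hs hτ) (t + τ) (add_nonneg ht hτ)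
  initial := by simp
  control_measurable := by
    have h1 : AEStronglyMeasurable a (volume.restrict (Ioi τ)) :=
      h.control_measurable.mono_set (Ioi_subset_Ioi hτ)
    simpa using aestronglyMeasurable_comp_add (τ := τ) measurableSet_Ioi h1
  deriv_eq := by
    filter_upwards [ae_restrict_Ioi_comp_add hτ h.deriv_eq] with t ht
    exact ht.comp_add_const t τ

theorem cost_split (hlam : 0 < lam)
    (hl₁ : CostRegular S₁) (hl₂ : CostRegular S₂) (h₁ : UniformBound S₁ C) (h₂ : UniformBound S₂ C)
    (h : IsTrajectory S₁ S₂ x₀ X a) {τ : ℝ} (hτ : 0 ≤ τ) :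
    cost S₁ S₂ lam X a =
      (∫ t in Ioc 0 τ, globalCost S₁ S₂ (X t) (a t) * Real.exp (-lam * t)) +
      Real.exp (-lam * τ) * cost S₁ S₂ lam (fun t => X (t + τ)) (fun t => a (t + τ)) := by
  have hi := h.integrableOn_cost hlam hl₁ hl₂ h₁ h₂
  unfold cost
  rw [← Ioc_union_Ioi_eq_Ioi hτ, setIntegral_union (Ioc_disjoint_Ioi le_rfl) measurableSet_Ioi
    (hi.mono_set Ioc_subset_Ioi_self) (hi.mono_set (Ioi_subset_Ioi hτ)), Ioc_union_Ioi_eq_Ioi hτ,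
    integral_Ioi_comp_add, ← integral_const_mul]
  congr 2
  ext t
  rw [mul_add, Real.exp_add]
  ring

/-- Trajectories whose control satisfies the constraint `P` while on the hyperplane. -/
structure IsConstrainedTrajectory (P : Space n → A₁ × A₂ × unitInterval → Prop)
    (S₁ : ControlSystem n A₁) (S₂ : ControlSystem n A₂) (x₀ : Space n)
    (X : ℝ → Space n) (a : ℝ → A₁ × A₂ × unitInterval) : Prop
    extends IsTrajectory S₁ S₂ x₀ X a where
  constraint : ∀ᵐ t ∂(volume.restrict (Ioi (0 : ℝ))), X t ∈ hyperplane n → P (X t) (a t)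

/-- Infimum of the cost over trajectories constrained by `P` on the hyperplane. -/
def constrainedValue (P : Space n → A₁ × A₂ × unitInterval → Prop)
    (S₁ : ControlSystem n A₁) (S₂ : ControlSystem n A₂) (lam : ℝ) (x₀ : Space n) : ℝ :=
  sInf {J | ∃ X a, IsConstrainedTrajectory P S₁ S₂ x₀ X a ∧ J = cost S₁ S₂ lam X a}

theorem valueMinus_eq : valueMinus S₁ S₂ lam = constrainedValue (fun _ _ => True) S₁ S₂ lam := by
  ext x₀
  unfold valueMinus constrainedValue
  congr 1
  ext J
  exact ⟨fun ⟨X, a, h, hJ⟩ => ⟨X, a, ⟨h, by simp⟩, hJ⟩, fun ⟨X, a, h, hJ⟩ => ⟨X, a, h.1, hJ⟩⟩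

theorem valuePlus_eq :
    valuePlus S₁ S₂ lam = constrainedValue (IsRegularControl S₁ S₂) S₁ S₂ lam := by
  ext x₀
  unfold valuePlus constrainedValue
  congr 1
  ext J
  exact ⟨fun ⟨X, a, h, hJ⟩ => ⟨X, a, ⟨h.1, h.2⟩, hJ⟩, fun ⟨X, a, h, hJ⟩ => ⟨X, a, ⟨h.1, h.2⟩, hJ⟩⟩

variable {P : Space n → A₁ × A₂ × unitInterval → Prop}

theorem IsConstrainedTrajectory.shift {τ : ℝ} (hτ : 0 ≤ τ)
    (h : IsConstrainedTrajectory P S₁ S₂ x₀ X a) :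
    IsConstrainedTrajectory P S₁ S₂ (X τ) (fun t => X (t + τ)) (fun t => a (t + τ)) where
  toIsTrajectory := h.toIsTrajectory.shift hτ
  constraint := ae_restrict_Ioi_comp_add hτ h.constraint

theorem constrainedValue_le_cost (hlam : 0 < lam) (h₁ : UniformBound S₁ C)
    (h₂ : UniformBound S₂ C) (h : IsConstrainedTrajectory P S₁ S₂ x₀ X a) :
    constrainedValue P S₁ S₂ lam x₀ ≤ cost S₁ S₂ lam X a := by
  refine csInf_le ⟨-(C / lam), ?_⟩ ⟨X, a, h, rfl⟩
  rintro J ⟨X, a, -, rfl⟩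
  exact (abs_le.1 (abs_cost_le hlam h₁ h₂ X a)).1

/-- Lower half of the dynamic programming principle. -/
theorem IsConstrainedTrajectory.le_cost (hlam : 0 < lam)
    (hl₁ : CostRegular S₁) (hl₂ : CostRegular S₂) (h₁ : UniformBound S₁ C) (h₂ : UniformBound S₂ C)
    (h : IsConstrainedTrajectory P S₁ S₂ x₀ X a) {τ : ℝ} (hτ : 0 ≤ τ) :
    (∫ t in Ioc 0 τ, globalCost S₁ S₂ (X t) (a t) * Real.exp (-lam * t)) +
      Real.exp (-lam * τ) * constrainedValue P S₁ S₂ lam (X τ) ≤ cost S₁ S₂ lam X a := by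
  rw [cost_split hlam hl₁ hl₂ h₁ h₂ h.toIsTrajectory hτ]
  gcongr
  exact constrainedValue_le_cost hlam h₁ h₂ (h.shift hτ)

/-- Following a segment first, then a given trajectory. -/
theorem exists_trajectory_segment_then {x v : Space n} {τ : ℝ} (hτ : 0 ≤ τ)
    {c : ℝ → A₁ × A₂ × unitInterval} (hc : StronglyMeasurable c)
    (hdyn : ∀ᵐ t, t ∈ Ioo 0 τ → globalDynamics S₁ S₂ (x + t • v) (c t) = v)
    (hcon : ∀ᵐ t, t ∈ Ioo 0 τ → x + t • v ∈ hyperplane n → P (x + t • v) (c t))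
    (h : IsConstrainedTrajectory P S₁ S₂ (x + τ • v) X a) :
    ∃ Y b, IsConstrainedTrajectory P S₁ S₂ x Y b ∧ (∀ t ∈ Ioc 0 τ, Y t = x + t • v ∧ b t = c t) ∧
      (∀ t ∈ Ioi (0 : ℝ), Y (t + τ) = X t ∧ b (t + τ) = a t) := by
  classical
  -- A single formula for the concatenation: the first term stops moving at time `τ`, the second
  -- starts then. The Lipschitz bound follows without splitting into cases.
  let Y : ℝ → Space n := fun t => (x + min t τ • v) + (X (max (t - τ) 0) - X 0)
  let b : ℝ → A₁ × A₂ × unitInterval := fun t => if t ≤ τ then c t else a (t - τ)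
  have hY1 : ∀ t, t ≤ τ → Y t = x + t • v := fun t ht => by
    simp [Y, min_eq_left ht, max_eq_right (sub_nonpos.2 ht)]
  have hY2 : ∀ t, τ ≤ t → Y t = X (t - τ) := fun t ht => by
    simp only [Y, min_eq_right ht, max_eq_left (sub_nonneg.2 ht), h.initial]
    abel
  have hb1 : ∀ t, t ≤ τ → b t = c t := fun t ht => if_pos ht
  have hb2 : ∀ t, τ < t → b t = a (t - τ) := fun t ht => if_neg (not_le.2 ht)
  -- almost every time is either interior to the segment, or a good time of the trajectory
  have hae : ∀ {p q : ℝ → Prop}, (∀ᵐ t, t ∈ Ioo 0 τ → p t) →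
      (∀ᵐ t ∂(volume.restrict (Ioi (0 : ℝ))), q t) →
      ∀ᵐ t ∂(volume.restrict (Ioi (0 : ℝ))), (t < τ ∧ p t) ∨ (τ < t ∧ q (t - τ)) := by
    intro p q hp hq
    rw [ae_restrict_iff' measurableSet_Ioi] at hq ⊢
    have hq' := (measurePreserving_sub_right volume τ).quasiMeasurePreserving.ae hq
    have hne : ∀ᵐ t : ℝ, t ≠ τ := by simp [ae_iff]
    filter_upwards [hp, hq', hne] with t h1 h2 h3 h4
    rcases lt_or_gt_of_ne h3 with h5 | h5
    · exact Or.inl ⟨h5, h1 ⟨h4, h5⟩⟩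
    · exact Or.inr ⟨h5, h2 (sub_pos.2 h5)⟩
  refine ⟨Y, b, ⟨⟨?_, ?_, ?_, ?_⟩, ?_⟩, fun t ht => ⟨hY1 t ht.2, hb1 t ht.2⟩, fun t ht => ?_⟩
  · obtain ⟨K, hK⟩ := h.lipschitz
    refine ⟨‖v‖₊ + K, LipschitzOnWith.of_dist_le_mul fun s _ t _ => ?_⟩
    have e1 : dist (min s τ) (min t τ) ≤ dist s t := by
      simpa using (LipschitzWith.id.min_const τ).dist_le_mul s t
    have e2 : dist (max (s - τ) 0) (max (t - τ) 0) ≤ dist s t := by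
      have := (LipschitzWith.id.max_const (0 : ℝ)).dist_le_mul (s - τ) (t - τ)
      simpa using this
    have e3 := hK.dist_le_mul (max (s - τ) 0) (mem_Ici.2 (le_max_right _ _))
      (max (t - τ) 0) (mem_Ici.2 (le_max_right _ _))
    calc dist (Y s) (Y t)
        ≤ dist (x + min s τ • v) (x + min t τ • v)
          + dist (X (max (s - τ) 0) - X 0) (X (max (t - τ) 0) - X 0) := dist_add_add_le _ _ _ _
      _ = ‖v‖ * dist (min s τ) (min t τ) + dist (X (max (s - τ) 0)) (X (max (t - τ) 0)) := by
          rw [dist_add_left, dist_sub_right, dist_eq_norm, ← sub_smul, norm_smul, mul_comm]; rfl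
      _ ≤ ‖v‖ * dist s t + K * dist s t := by
          gcongr
          exact e3.trans (by gcongr)
      _ = _ := by push_cast; ring
  · rw [hY1 0 hτ]; simp
  · rw [← Ioc_union_Ioi_eq_Ioi hτ, aestronglyMeasurable_union_iff]
    constructor
    · refine hc.aestronglyMeasurable.congr ?_
      filter_upwards [self_mem_ae_restrict measurableSet_Ioc] with t ht using (hb1 t ht.2).symm
    · have := aestronglyMeasurable_comp_add (τ := -τ) measurableSet_Ioi h.control_measurable
      rw [preimage_add_const_Ioi, zero_sub, neg_neg] at this
      simp only [← sub_eq_add_neg] at this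
      refine this.congr ?_
      filter_upwards [self_mem_ae_restrict measurableSet_Ioi] with t ht using (hb2 t ht).symm
  · filter_upwards [hae hdyn h.deriv_eq] with t ht
    rcases ht with ⟨ht, h1⟩ | ⟨ht, h1⟩
    · rw [hY1 t ht.le, hb1 t ht.le, h1]
      have e : HasDerivAt (fun t : ℝ => x + t • v) v t := by
        simpa using ((hasDerivAt_id t).smul_const v).const_add x
      refine e.congr_of_eventuallyEq ?_
      filter_upwards [Iio_mem_nhds ht] with s hs using hY1 s (le_of_lt hs)
    · rw [hY2 t ht.le, hb2 t ht]
      have e := h1.comp_sub_const t τ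
      refine e.congr_of_eventuallyEq ?_
      filter_upwards [Ioi_mem_nhds ht] with s hs using hY2 s (le_of_lt hs)
  · filter_upwards [hae hcon h.constraint] with t ht
    rcases ht with ⟨ht, h1⟩ | ⟨ht, h1⟩
    · rwa [hY1 t ht.le, hb1 t ht.le]
    · rwa [hY2 t ht.le, hb2 t ht]
  · have h0 : τ < t + τ := lt_add_of_pos_left _ ht
    rw [hY2 _ h0.le, hb2 _ h0]
    simp

theorem setIntegral_exp_discount (hlam : 0 < lam) {τ : ℝ} (hτ : 0 ≤ τ) :
    ∫ t in Ioc 0 τ, Real.exp (-lam * t) = (1 - Real.exp (-lam * τ)) / lam := by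
  rw [← intervalIntegral.integral_of_le hτ]
  have hd : ∀ t ∈ uIcc 0 τ,
      HasDerivAt (fun t => -Real.exp (-lam * t) / lam) (Real.exp (-lam * t)) t := fun t _ => by
    have := (((hasDerivAt_id t).const_mul (-lam)).exp.neg).div_const lam
    refine this.congr_deriv ?_
    simp only [id]
    field_simp
  rw [intervalIntegral.integral_eq_sub_of_hasDerivAt hd
    (Continuous.intervalIntegrable (by fun_prop) _ _)]
  simp
  ring

/-- Upper half of the dynamic programming principle, along segments. -/
theorem constrainedValue_le_segment (hlam : 0 < lam)
    (hl₁ : CostRegular S₁) (hl₂ : CostRegular S₂) (h₁ : UniformBound S₁ C) (h₂ : UniformBound S₂ C)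
    {x v : Space n} {m τ : ℝ} (hτ : 0 ≤ τ)
    {c : ℝ → A₁ × A₂ × unitInterval} (hc : StronglyMeasurable c)
    (hdyn : ∀ᵐ t, t ∈ Ioo 0 τ → globalDynamics S₁ S₂ (x + t • v) (c t) = v)
    (hcon : ∀ᵐ t, t ∈ Ioo 0 τ → x + t • v ∈ hyperplane n → P (x + t • v) (c t))
    (hcost : ∀ᵐ t, t ∈ Ioo 0 τ → globalCost S₁ S₂ (x + t • v) (c t) ≤ m)
    (hne : ∃ X a, IsConstrainedTrajectory P S₁ S₂ (x + τ • v) X a) :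
    constrainedValue P S₁ S₂ lam x ≤ m * ((1 - Real.exp (-lam * τ)) / lam) +
      Real.exp (-lam * τ) * constrainedValue P S₁ S₂ lam (x + τ • v) := by
  have he := Real.exp_pos (-lam * τ)
  -- With the value at the endpoint isolated, it suffices to bound the cost of each continuation
  -- from below; no nearly optimal one has to be chosen.
  rw [← sub_le_iff_le_add', ← div_le_iff₀' he]
  obtain ⟨X, a, h⟩ := hne
  refine le_csInf ⟨_, X, a, h, rfl⟩ ?_
  rintro J ⟨X, a, h, rfl⟩
  obtain ⟨Y, b, hYb, hY1, hY2⟩ := exists_trajectory_segment_then hτ hc hdyn hcon h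
  rw [div_le_iff₀' he, sub_le_iff_le_add']
  refine (constrainedValue_le_cost hlam h₁ h₂ hYb).trans ?_
  rw [cost_split hlam hl₁ hl₂ h₁ h₂ hYb.toIsTrajectory hτ]
  have e2 : cost S₁ S₂ lam (fun t => Y (t + τ)) (fun t => b (t + τ)) = cost S₁ S₂ lam X a := by
    refine setIntegral_congr_fun measurableSet_Ioi fun t ht => ?_
    simp only [(hY2 t ht).1, (hY2 t ht).2]
  rw [e2]
  gcongr
  rw [← setIntegral_exp_discount hlam hτ, ← integral_const_mul]
  refine setIntegral_mono_on_ae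
    ((hYb.integrableOn_cost hlam hl₁ hl₂ h₁ h₂).mono_set Ioc_subset_Ioi_self)
    (((integrableOn_exp_discount hlam 0).mono_set Ioc_subset_Ioi_self).const_mul m)
    measurableSet_Ioc ?_
  have hne : ∀ᵐ t : ℝ, t ≠ τ := by simp [ae_iff]
  filter_upwards [hcost, hne] with t h1 h2 h3
  rw [(hY1 t h3).1, (hY1 t h3).2]
  gcongr
  exact h1 ⟨h3.1, lt_of_le_of_ne h3.2 h2⟩

theorem exists_stationary_trajectory (hP : ∀ x a, IsRegularControl S₁ S₂ x a → P x a)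
    {x : Space n} (h₁ : 0 ∈ range (S₁.b x)) (h₂ : 0 ∈ range (S₂.b x)) :
    ∃ X a, IsConstrainedTrajectory P S₁ S₂ x X a := by
  obtain ⟨α₁, e₁⟩ := h₁
  obtain ⟨α₂, e₂⟩ := h₂
  -- Both velocities vanish at `x`, so resting is a solution in every region and is regular on the
  -- hyperplane.
  refine ⟨fun _ => x, fun _ => (α₁, α₂, 0), ⟨⟨⟨0, ?_⟩, rfl, aestronglyMeasurable_const, ?_⟩, ?_⟩⟩
  · exact (LipschitzWith.const x).lipschitzOnWith
  · have : globalDynamics S₁ S₂ x (α₁, α₂, 0) = 0 := by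
      simp [globalDynamics, mixedDynamics, e₁, e₂]
    filter_upwards with t
    rw [this]
    exact hasDerivAt_const t x
  · filter_upwards with t _
    refine hP _ _ ⟨?_, ?_⟩ <;> simp [e₁, e₂, normalCoord]

theorem abs_constrainedValue_le (hlam : 0 < lam) (h₁ : UniformBound S₁ C) (h₂ : UniformBound S₂ C)
    {x : Space n} (hne : ∃ X a, IsConstrainedTrajectory P S₁ S₂ x X a) :
    |constrainedValue P S₁ S₂ lam x| ≤ C / lam := by
  obtain ⟨X, a, h⟩ := hne
  rw [abs_le]
  constructor
  · refine le_csInf ⟨_, X, a, h, rfl⟩ ?_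
    rintro J ⟨X, a, -, rfl⟩
    exact (abs_le.1 (abs_cost_le hlam h₁ h₂ X a)).1
  · exact (constrainedValue_le_cost hlam h₁ h₂ h).trans (abs_le.1 (abs_cost_le hlam h₁ h₂ X a)).2

end Trajectories

/-! ### Short segments and their infinitesimal inequalities -/

open Filter Topology

theorem eventually_forall_mem_Icc {p : ℝ → Prop} (h : ∀ᶠ t in 𝓝 (0 : ℝ), p t) :
    ∀ᶠ τ in 𝓝[>] (0 : ℝ), ∀ t ∈ Icc 0 τ, p t := by
  obtain ⟨r, hr, h⟩ := Metric.eventually_nhds_iff.1 h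
  filter_upwards [Ioo_mem_nhdsGT hr] with τ hτ t ht
  refine h ?_
  rw [dist_zero_right, Real.norm_of_nonneg ht.1]
  exact ht.2.trans_lt hτ.2

theorem eventually_forall_mem_Ioo {p : ℝ → Prop} (h : ∀ᶠ t in 𝓝[>] (0 : ℝ), p t) :
    ∀ᶠ τ in 𝓝[>] (0 : ℝ), ∀ t ∈ Ioo 0 τ, p t := by
  obtain ⟨r, hr, h⟩ := mem_nhdsGT_iff_exists_Ioo_subset.1 h
  filter_upwards [Ioo_mem_nhdsGT hr] with τ hτ t ht
  exact h ⟨ht.1, ht.2.trans hτ.2⟩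

theorem tendsto_add_smul {E : Type*} [NormedAddCommGroup E] [NormedSpace ℝ E] (x v : E) :
    Tendsto (fun t : ℝ => x + t • v) (𝓝 0) (𝓝 x) := by
  have : Continuous fun t : ℝ => x + t • v := by fun_prop
  simpa using this.tendsto 0

/-- Near `x` the velocity `b(x, α)`, slightly shortened, is available at almost the same cost. -/
theorem eventually_exists_control {n : ℕ} {A : Type*} [TopologicalSpace A]
    {S : ControlSystem n A} {C δ ε : ℝ} (hb : DynamicsRegular S) (hl : CostRegular S)
    (hc : ClosedConvexImages S) (hδ : 0 < δ) (hS : Controllable S δ) (hC : UniformBound S C)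
    (x : Space n) (α : A) (hε : ε ∈ Ioo (0 : ℝ) 1) :
    ∀ᶠ y in 𝓝 x, ∃ β, S.b y β = (1 - ε) • S.b x α ∧ S.l y β ≤ S.l x α + ε * (2 * C + 1) := by
  have cb : Continuous fun y => S.b y α := hb.continuous.comp (by fun_prop : Continuous fun y => (y, α))
  have cl : Continuous fun y => S.l y α := hl.continuous.comp (by fun_prop : Continuous fun y => (y, α))
  filter_upwards [Metric.tendsto_nhds.1 (cb.tendsto x) (ε * δ) (mul_pos hε.1 hδ),
    Metric.tendsto_nhds.1 (cl.tendsto x) ε hε.1] with y h1 h2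
  rw [dist_comm, dist_eq_norm] at h1
  rw [Real.dist_eq] at h2
  -- A correcting velocity: mixing `b(y, α)` and `b(y, γ)` with weights `1 - ε` and `ε` gives
  -- exactly `(1 - ε) • b(x, α)`. It lies in the `δ`-ball because `b(y, α)` is within `ε * δ` of
  -- `b(x, α)`.
  obtain ⟨γ, hγ⟩ : ((1 - ε) / ε) • (S.b x α - S.b y α) ∈ range (S.b y) := by
    refine hS y ?_
    rw [mem_closedBall_zero_iff, norm_smul,
      Real.norm_of_nonneg (div_nonneg (sub_nonneg.2 hε.2.le) hε.1.le), div_mul_eq_mul_div,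
      div_le_iff₀ hε.1]
    nlinarith [norm_nonneg (S.b x α - S.b y α), hε.1, hε.2]
  obtain ⟨β, hβ⟩ := (hc y).2 ⟨α, rfl⟩ ⟨γ, rfl⟩ (sub_nonneg.2 hε.2.le) hε.1.le (by ring)
  simp only [Prod.smul_mk, Prod.mk_add_mk, Prod.mk.injEq] at hβ
  refine ⟨β, ?_, ?_⟩
  · rw [hβ.1, hγ, smul_smul, mul_div_cancel₀ _ hε.1.ne', ← smul_add, add_sub_cancel]
  · rw [hβ.2]
    simp only [smul_eq_mul]
    have e1 := (abs_lt.1 h2).2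
    have e2 := (abs_le.1 (hC.l y γ)).2
    have e3 := (abs_le.1 (hC.l x α)).1
    nlinarith [hε.1, hε.2]

/-- Infinitesimal form of an inequality holding along a short segment. -/
theorem le_add_deriv_of_eventually_le {ψ : ℝ → ℝ} {d m u lam : ℝ} (hlam : 0 < lam)
    (hψ : HasDerivAt ψ d 0)
    (h : ∀ᶠ τ in 𝓝[>] (0 : ℝ), u ≤ m * ((1 - Real.exp (-lam * τ)) / lam) +
      Real.exp (-lam * τ) * (u + (ψ τ - ψ 0))) : lam * u ≤ m + d := by
  have he : HasDerivAt (fun τ => Real.exp (-lam * τ)) (-lam) 0 := by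
    simpa using ((hasDerivAt_id (0 : ℝ)).const_mul (-lam)).exp
  have hg : HasDerivAt (fun τ => m * ((1 - Real.exp (-lam * τ)) / lam) +
      Real.exp (-lam * τ) * (u + (ψ τ - ψ 0))) (m - lam * u + d) 0 := by
    refine ((((he.const_sub 1).div_const lam).const_mul m).add
      (he.mul ((hψ.sub_const (ψ 0)).const_add u))).congr_deriv ?_
    simp
    field_simp
    ring
  have hs := hasDerivAt_iff_tendsto_slope.1 hg
  -- The right-hand side equals `u` at `τ = 0` and is at least `u` for small `τ > 0`, so its
  -- derivative at `0` is nonnegative.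
  have hs' := hs.mono_left (nhdsWithin_mono (0 : ℝ) (show Ioi (0 : ℝ) ⊆ {0}ᶜ from
    fun t ht => (mem_Ioi.1 ht).ne'))
  have : 0 ≤ m - lam * u + d := by
    refine ge_of_tendsto hs' ?_
    filter_upwards [h, self_mem_nhdsWithin] with τ h1 h2
    rw [slope_def_field]
    refine div_nonneg ?_ (by simpa using (mem_Ioi.1 h2).le)
    simpa using h1
  linarith

/-- Derivation of the subsolution inequality in the direction `w` at a local maximum relative to `s`. -/
theorem le_add_fderiv_of_isLocalMaxOn {n : ℕ} {U φ : Space n → ℝ} {φ' : Space n →L[ℝ] ℝ}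
    {s : Set (Space n)} {x w : Space n} {lam l M : ℝ} (hlam : 0 < lam)
    (hφ : HasFDerivAt φ φ' x) (hmax : IsLocalMaxOn (fun y => U y - φ y) s x)
    (hs : ∀ᶠ t in 𝓝[>] (0 : ℝ), x + t • w ∈ s)
    (h : ∀ ε ∈ Ioo (0 : ℝ) 1, ∀ᶠ τ in 𝓝[>] (0 : ℝ),
      U x ≤ (l + ε * M) * ((1 - Real.exp (-lam * τ)) / lam) +
        Real.exp (-lam * τ) * U (x + τ • (1 - ε) • w)) :
    lam * U x ≤ l + φ' w := by
  have key : ∀ ε ∈ Ioo (0 : ℝ) 1, lam * U x ≤ l + ε * M + (1 - ε) * φ' w := by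
    intro ε hε
    have hψ : HasDerivAt (fun τ : ℝ => φ (x + τ • (1 - ε) • w)) ((1 - ε) * φ' w) 0 := by
      have e : HasDerivAt (fun τ : ℝ => x + τ • (1 - ε) • w) ((1 - ε) • w) 0 := by
        simpa using ((hasDerivAt_id (0 : ℝ)).smul_const ((1 - ε) • w)).const_add x
      have hφ0 : HasFDerivAt φ φ' (x + (0 : ℝ) • (1 - ε) • w) := by simpa using hφ
      simpa [Function.comp_def] using hφ0.comp_hasDerivAt (0 : ℝ) e
    refine le_add_deriv_of_eventually_le hlam hψ ?_
    have hscale : Tendsto (fun τ : ℝ => τ * (1 - ε)) (𝓝[>] 0) (𝓝[>] 0) := by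
      refine tendsto_nhdsWithin_iff.2 ⟨?_, ?_⟩
      · have : Continuous fun τ : ℝ => τ * (1 - ε) := by fun_prop
        simpa using (this.tendsto 0).mono_left nhdsWithin_le_nhds
      · filter_upwards [self_mem_nhdsWithin] with τ hτ
        exact mul_pos hτ (sub_pos.2 hε.2)
    have hs' : ∀ᶠ τ in 𝓝[>] (0 : ℝ), x + τ • (1 - ε) • w ∈ s := by
      filter_upwards [hscale.eventually hs] with τ hτ
      rwa [smul_smul]
    have ht : Tendsto (fun τ : ℝ => x + τ • (1 - ε) • w) (𝓝[>] 0) (𝓝[s] x) :=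
      tendsto_nhdsWithin_iff.2 ⟨(tendsto_add_smul _ _).mono_left nhdsWithin_le_nhds, hs'⟩
    filter_upwards [h ε hε, ht.eventually hmax] with τ h1 h2
    refine h1.trans ?_
    gcongr
    simp only [zero_smul, add_zero]
    linarith
  have hlim : Tendsto (fun ε => l + ε * M + (1 - ε) * φ' w) (𝓝[>] (0 : ℝ)) (𝓝 (l + φ' w)) := by
    have : Continuous fun ε => l + ε * M + (1 - ε) * φ' w := by fun_prop
    simpa using (this.tendsto 0).mono_left nhdsWithin_le_nhds
  refine ge_of_tendsto hlim ?_
  filter_upwards [Ioo_mem_nhdsGT (one_pos : (0 : ℝ) < 1)] with ε hε using key ε hε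

/-! ### Regularity of the value and its estimates along segments -/

/-- The hypotheses of the two-domain problem, with explicit bounds. -/
structure StandingAssumptions [TopologicalSpace A₁] [TopologicalSpace A₂]
    (S₁ : ControlSystem n A₁) (S₂ : ControlSystem n A₂) (lam δ C : ℝ) : Prop where
  lam_pos : 0 < lam
  b₁ : DynamicsRegular S₁
  b₂ : DynamicsRegular S₂
  l₁ : CostRegular S₁
  l₂ : CostRegular S₂
  convex₁ : ClosedConvexImages S₁
  convex₂ : ClosedConvexImages S₂
  δ_pos : 0 < δ
  controllable₁ : Controllable S₁ δ
  controllable₂ : Controllable S₂ δ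
  bound₁ : UniformBound S₁ C
  bound₂ : UniformBound S₂ C

theorem globalDynamics_of_mem_upperHalf {S₁ : ControlSystem n A₁} {S₂ : ControlSystem n A₂}
    {x : Space n} (hx : x ∈ upperHalf n) (a : A₁ × A₂ × unitInterval) :
    globalDynamics S₁ S₂ x a = S₁.b x a.1 := if_pos hx

theorem globalCost_of_mem_upperHalf {S₁ : ControlSystem n A₁} {S₂ : ControlSystem n A₂}
    {x : Space n} (hx : x ∈ upperHalf n) (a : A₁ × A₂ × unitInterval) :
    globalCost S₁ S₂ x a = S₁.l x a.1 := if_pos hx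

theorem not_mem_upperHalf_of_mem_lowerHalf {x : Space n} (hx : x ∈ lowerHalf n) :
    x ∉ upperHalf n := fun h => lt_asymm (show normalCoord x < 0 from hx) h

theorem not_mem_upperHalf_of_mem_hyperplane {x : Space n} (hx : x ∈ hyperplane n) :
    x ∉ upperHalf n := fun h =>
  absurd (show normalCoord x = 0 from hx) (show 0 < normalCoord x from h).ne'

theorem not_mem_lowerHalf_of_mem_hyperplane {x : Space n} (hx : x ∈ hyperplane n) :
    x ∉ lowerHalf n := fun h =>
  absurd (show normalCoord x = 0 from hx) (show normalCoord x < 0 from h).ne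

theorem globalDynamics_of_mem_lowerHalf {S₁ : ControlSystem n A₁} {S₂ : ControlSystem n A₂}
    {x : Space n} (hx : x ∈ lowerHalf n) (a : A₁ × A₂ × unitInterval) :
    globalDynamics S₁ S₂ x a = S₂.b x a.2.1 :=
  (if_neg (not_mem_upperHalf_of_mem_lowerHalf hx)).trans (if_pos hx)

theorem globalCost_of_mem_lowerHalf {S₁ : ControlSystem n A₁} {S₂ : ControlSystem n A₂}
    {x : Space n} (hx : x ∈ lowerHalf n) (a : A₁ × A₂ × unitInterval) :
    globalCost S₁ S₂ x a = S₂.l x a.2.1 :=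
  (if_neg (not_mem_upperHalf_of_mem_lowerHalf hx)).trans (if_pos hx)

theorem globalDynamics_of_mem_hyperplane {S₁ : ControlSystem n A₁} {S₂ : ControlSystem n A₂}
    {x : Space n} (hx : x ∈ hyperplane n) (a : A₁ × A₂ × unitInterval) :
    globalDynamics S₁ S₂ x a = mixedDynamics S₁ S₂ x a :=
  (if_neg (not_mem_upperHalf_of_mem_hyperplane hx)).trans
    (if_neg (not_mem_lowerHalf_of_mem_hyperplane hx))

theorem globalCost_of_mem_hyperplane {S₁ : ControlSystem n A₁} {S₂ : ControlSystem n A₂}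
    {x : Space n} (hx : x ∈ hyperplane n) (a : A₁ × A₂ × unitInterval) :
    globalCost S₁ S₂ x a = mixedCost S₁ S₂ x a :=
  (if_neg (not_mem_upperHalf_of_mem_hyperplane hx)).trans
    (if_neg (not_mem_lowerHalf_of_mem_hyperplane hx))

section Value

variable [MetricSpace A₁] [CompactSpace A₁] [MetricSpace A₂] [CompactSpace A₂]
  {S₁ : ControlSystem n A₁} {S₂ : ControlSystem n A₂} {lam δ C : ℝ}
  {P : Space n → A₁ × A₂ × unitInterval → Prop}

omit [CompactSpace A₁] [CompactSpace A₂] in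
theorem StandingAssumptions.exists_trajectory (H : StandingAssumptions S₁ S₂ lam δ C)
    (hP : ∀ x a, IsRegularControl S₁ S₂ x a → P x a) (x : Space n) :
    ∃ X a, IsConstrainedTrajectory P S₁ S₂ x X a :=
  exists_stationary_trajectory hP
    (H.controllable₁ x (Metric.mem_closedBall_self H.δ_pos.le))
    (H.controllable₂ x (Metric.mem_closedBall_self H.δ_pos.le))

omit [CompactSpace A₁] [CompactSpace A₂] in
theorem StandingAssumptions.abs_value_le (H : StandingAssumptions S₁ S₂ lam δ C)
    (hP : ∀ x a, IsRegularControl S₁ S₂ x a → P x a) (x : Space n) :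
    |constrainedValue P S₁ S₂ lam x| ≤ C / lam :=
  abs_constrainedValue_le H.lam_pos H.bound₁ H.bound₂ (H.exists_trajectory hP x)

omit [MetricSpace A₁] [CompactSpace A₁] [MetricSpace A₂] [CompactSpace A₂] in
theorem mixedDynamics_one (x : Space n) (α₁ : A₁) (α₂ : A₂) :
    mixedDynamics S₁ S₂ x (α₁, α₂, 1) = S₁.b x α₁ := by
  simp [mixedDynamics]

/-- Both systems can realize any velocity of norm `δ`, so `y` is reached from `x` along a segment in
time `‖y - x‖ / δ`. The running cost and the discounting of the value at `y` each contribute at most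
`C` per unit of time. -/
theorem StandingAssumptions.value_le_value_add (H : StandingAssumptions S₁ S₂ lam δ C)
    (hP : ∀ x a, IsRegularControl S₁ S₂ x a → P x a) (x y : Space n) :
    constrainedValue P S₁ S₂ lam x ≤ constrainedValue P S₁ S₂ lam y + 2 * C / δ * ‖y - x‖ := by
  rcases eq_or_ne y x with rfl | hxy
  · simp
  have hr : 0 < ‖y - x‖ := norm_pos_iff.2 (sub_ne_zero.2 hxy)
  have hδ := H.δ_pos
  set v : Space n := (δ / ‖y - x‖) • (y - x) with hv
  set τ : ℝ := ‖y - x‖ / δ with hτ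
  have hτ0 : 0 ≤ τ := by positivity
  have hxv : x + τ • v = y := by
    rw [hv, smul_smul, hτ, div_mul_div_cancel₀ hδ.ne', div_self hr.ne', one_smul]
    abel
  have hvn : v ∈ Metric.closedBall (0 : Space n) δ := by
    rw [mem_closedBall_zero_iff, hv, norm_smul, Real.norm_of_nonneg (by positivity),
      div_mul_cancel₀ _ hr.ne']
  obtain ⟨α₁, hα₁, k₁⟩ := exists_control_on_segment H.b₁ H.l₁ (x := x) (v := v) (w := v) (m := C) hτ0
    fun t _ => (H.controllable₁ (x + t • v) hvn).imp
      fun α hα => ⟨hα, (abs_le.1 (H.bound₁.l _ _)).2⟩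
  obtain ⟨α₂, hα₂, k₂⟩ := exists_control_on_segment H.b₂ H.l₂ (x := x) (v := v) (w := v) (m := C) hτ0
    fun t _ => (H.controllable₂ (x + t • v) hvn).imp
      fun α hα => ⟨hα, (abs_le.1 (H.bound₂.l _ _)).2⟩
  -- Either the segment is parallel to the hyperplane, or it meets it at one time at most, which is
  -- negligible. So the control is regular wherever this matters.
  have hreg : ∀ᵐ t : ℝ, x + t • v ∈ hyperplane n → normalCoord v = 0 := by
    by_cases h0 : normalCoord v = 0
    · simp [h0]
    · have hne : ∀ᵐ t : ℝ, t ≠ -normalCoord x / normalCoord v := by simp [ae_iff]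
      filter_upwards [hne] with t ht hmem
      exfalso
      have : normalCoord (x + t • v) = 0 := hmem
      rw [normalCoord_add, normalCoord_smul] at this
      exact ht (by rw [eq_div_iff h0]; linarith)
  have key := constrainedValue_le_segment (P := P) (S₁ := S₁) (S₂ := S₂) H.lam_pos H.l₁ H.l₂ H.bound₁ H.bound₂
    (x := x) (v := v) (m := C)
    -- Both controls produce the velocity `v`, so the mixing weight is irrelevant; `1` is chosen.
    hτ0 (c := fun t => (α₁ t, α₂ t, 1)) (hα₁.prodMk (hα₂.prodMk stronglyMeasurable_const))
    (Eventually.of_forall fun t ht => by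
      unfold globalDynamics
      split_ifs
      · exact (k₁ t (Ioo_subset_Icc_self ht)).1
      · exact (k₂ t (Ioo_subset_Icc_self ht)).1
      · rw [mixedDynamics_one]; exact (k₁ t (Ioo_subset_Icc_self ht)).1)
    (by
      filter_upwards [hreg] with t h1 ht hmem
      refine hP _ _ ⟨?_, ?_⟩
      · simp only [(k₁ t (Ioo_subset_Icc_self ht)).1, h1 hmem, le_refl]
      · simp only [(k₂ t (Ioo_subset_Icc_self ht)).1, h1 hmem, le_refl])
    (Eventually.of_forall fun t _ => (abs_le.1 (abs_globalCost_le H.bound₁ H.bound₂ _ _)).2)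
    (H.exists_trajectory hP _)
  rw [hxv] at key
  have hC := H.abs_value_le hP y
  have hl := H.lam_pos
  have hK : (1 - Real.exp (-lam * τ)) / lam ≤ τ := by
    rw [div_le_iff₀ hl]
    nlinarith [Real.add_one_le_exp (-lam * τ)]
  have hK0 : 0 ≤ (1 - Real.exp (-lam * τ)) / lam := by
    refine div_nonneg (sub_nonneg.2 (Real.exp_le_one_iff.2 ?_)) hl.le
    nlinarith
  have hC0 : 0 ≤ C / lam := (abs_nonneg _).trans hC
  have hC1 : 0 ≤ C := by
    have := mul_nonneg hC0 hl.le
    rwa [div_mul_cancel₀ _ hl.ne'] at this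
  set e := Real.exp (-lam * τ)
  set K := (1 - e) / lam with hKdef
  have he : e = 1 - lam * K := by rw [hKdef]; field_simp; ring
  have h3 : -(lam * K * constrainedValue P S₁ S₂ lam y) ≤ C * K := by
    have := (abs_le.1 hC).1
    rw [neg_le_iff_add_nonneg, ← sub_nonneg] at this
    have h4 : 0 ≤ lam * K * (constrainedValue P S₁ S₂ lam y + C / lam) := by
      have : 0 ≤ constrainedValue P S₁ S₂ lam y + C / lam := by linarith
      positivity
    have h5 : lam * K * (C / lam) = C * K := by field_simp
    nlinarith
  have h6 : C * K ≤ C * τ := by gcongr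
  have h7 : 2 * C / δ * ‖y - x‖ = 2 * (C * τ) := by rw [hτ]; ring
  rw [he] at key
  rw [h7]
  nlinarith

theorem StandingAssumptions.continuous_value (H : StandingAssumptions S₁ S₂ lam δ C)
    (hP : ∀ x a, IsRegularControl S₁ S₂ x a → P x a) :
    Continuous (constrainedValue P S₁ S₂ lam) := by
  refine (LipschitzWith.of_dist_le' (K := 2 * C / δ) fun x y => ?_).continuous
  rw [Real.dist_eq, abs_sub_le_iff, dist_eq_norm]
  have h1 := H.value_le_value_add hP x y
  have h2 := H.value_le_value_add hP y x
  rw [norm_sub_rev] at h1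
  constructor <;> linarith

-- Only the first control acts while the segment is in the upper half-space, so the other components
-- are arbitrary and `P` is vacuous. The starting point may lie on the hyperplane, since only times
-- in the open interval count.
omit [CompactSpace A₂] in
theorem StandingAssumptions.eventually_value_le_upper (H : StandingAssumptions S₁ S₂ lam δ C)
    (hP : ∀ x a, IsRegularControl S₁ S₂ x a → P x a) {x : Space n} {α : A₁} {ε : ℝ}
    (hε : ε ∈ Ioo (0 : ℝ) 1)
    (hin : ∀ᶠ t in 𝓝[>] (0 : ℝ), x + t • (1 - ε) • S₁.b x α ∈ upperHalf n) :
    ∀ᶠ τ in 𝓝[>] (0 : ℝ), constrainedValue P S₁ S₂ lam x ≤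
      (S₁.l x α + ε * (2 * C + 1)) * ((1 - Real.exp (-lam * τ)) / lam) +
        Real.exp (-lam * τ) * constrainedValue P S₁ S₂ lam (x + τ • (1 - ε) • S₁.b x α) := by
  have near := eventually_exists_control H.b₁ H.l₁ H.convex₁ H.δ_pos H.controllable₁ H.bound₁ x α hε
  obtain ⟨α₂, -⟩ := H.controllable₂ x (Metric.mem_closedBall_self H.δ_pos.le)
  filter_upwards [eventually_forall_mem_Icc ((tendsto_add_smul x _).eventually near),
    eventually_forall_mem_Ioo hin, self_mem_nhdsWithin] with τ h1 h2 hτ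
  obtain ⟨β, hβ, k⟩ := exists_control_on_segment H.b₁ H.l₁ (mem_Ioi.1 hτ).le h1
  refine constrainedValue_le_segment H.lam_pos H.l₁ H.l₂ H.bound₁ H.bound₂ (mem_Ioi.1 hτ).le
    (c := fun t => (β t, α₂, 1)) (hβ.prodMk (stronglyMeasurable_const.prodMk stronglyMeasurable_const))
    (Eventually.of_forall fun t ht => ?_) (Eventually.of_forall fun t ht hmem => ?_)
    (Eventually.of_forall fun t ht => ?_) (H.exists_trajectory hP _)
  · rw [globalDynamics_of_mem_upperHalf (h2 t ht)]
    exact (k t (Ioo_subset_Icc_self ht)).1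
  · exact absurd (h2 t ht) (not_mem_upperHalf_of_mem_hyperplane hmem)
  · rw [globalCost_of_mem_upperHalf (h2 t ht)]
    exact (k t (Ioo_subset_Icc_self ht)).2

omit [CompactSpace A₁] in
theorem StandingAssumptions.eventually_value_le_lower (H : StandingAssumptions S₁ S₂ lam δ C)
    (hP : ∀ x a, IsRegularControl S₁ S₂ x a → P x a) {x : Space n} {α : A₂} {ε : ℝ}
    (hε : ε ∈ Ioo (0 : ℝ) 1)
    (hin : ∀ᶠ t in 𝓝[>] (0 : ℝ), x + t • (1 - ε) • S₂.b x α ∈ lowerHalf n) :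
    ∀ᶠ τ in 𝓝[>] (0 : ℝ), constrainedValue P S₁ S₂ lam x ≤
      (S₂.l x α + ε * (2 * C + 1)) * ((1 - Real.exp (-lam * τ)) / lam) +
        Real.exp (-lam * τ) * constrainedValue P S₁ S₂ lam (x + τ • (1 - ε) • S₂.b x α) := by
  have near := eventually_exists_control H.b₂ H.l₂ H.convex₂ H.δ_pos H.controllable₂ H.bound₂ x α hε
  obtain ⟨α₁, -⟩ := H.controllable₁ x (Metric.mem_closedBall_self H.δ_pos.le)
  filter_upwards [eventually_forall_mem_Icc ((tendsto_add_smul x _).eventually near),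
    eventually_forall_mem_Ioo hin, self_mem_nhdsWithin] with τ h1 h2 hτ
  obtain ⟨β, hβ, k⟩ := exists_control_on_segment H.b₂ H.l₂ (mem_Ioi.1 hτ).le h1
  refine constrainedValue_le_segment H.lam_pos H.l₁ H.l₂ H.bound₁ H.bound₂ (mem_Ioi.1 hτ).le
    (c := fun t => (α₁, β t, 1)) (stronglyMeasurable_const.prodMk (hβ.prodMk stronglyMeasurable_const))
    (Eventually.of_forall fun t ht => ?_) (Eventually.of_forall fun t ht hmem => ?_)
    (Eventually.of_forall fun t ht => ?_) (H.exists_trajectory hP _)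
  · rw [globalDynamics_of_mem_lowerHalf (h2 t ht)]
    exact (k t (Ioo_subset_Icc_self ht)).1
  · exact absurd (h2 t ht) (not_mem_lowerHalf_of_mem_hyperplane hmem)
  · rw [globalCost_of_mem_lowerHalf (h2 t ht)]
    exact (k t (Ioo_subset_Icc_self ht)).2

/-- Both velocities are shortened by the same factor `1 - ε` with the weight `μ` unchanged, so the
mixture stays tangential. The hypothesis `hPa` says that the constraint survives this scaling, even
at other points. -/
theorem StandingAssumptions.eventually_value_le_tangential (H : StandingAssumptions S₁ S₂ lam δ C)
    (hP : ∀ x a, IsRegularControl S₁ S₂ x a → P x a) {x : Space n} (hx : x ∈ hyperplane n)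
    {a : A₁ × A₂ × unitInterval} (ha : a ∈ tangentialControls S₁ S₂ x)
    (hPa : ∀ y b (r : ℝ), 0 < r → S₁.b y b.1 = r • S₁.b x a.1 → S₂.b y b.2.1 = r • S₂.b x a.2.1 →
      P y b) {ε : ℝ} (hε : ε ∈ Ioo (0 : ℝ) 1) :
    ∀ᶠ τ in 𝓝[>] (0 : ℝ), constrainedValue P S₁ S₂ lam x ≤
      (mixedCost S₁ S₂ x a + ε * (2 * C + 1)) * ((1 - Real.exp (-lam * τ)) / lam) +
        Real.exp (-lam * τ) *
          constrainedValue P S₁ S₂ lam (x + τ • (1 - ε) • mixedDynamics S₁ S₂ x a) := by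
  have near₁ :=
    eventually_exists_control H.b₁ H.l₁ H.convex₁ H.δ_pos H.controllable₁ H.bound₁ x a.1 hε
  have near₂ :=
    eventually_exists_control H.b₂ H.l₂ H.convex₂ H.δ_pos H.controllable₂ H.bound₂ x a.2.1 hε
  set v := (1 - ε) • mixedDynamics S₁ S₂ x a with hv
  have hmem : ∀ t : ℝ, x + t • v ∈ hyperplane n := fun t => by
    have h1 : normalCoord x = 0 := hx
    have h2 : normalCoord (mixedDynamics S₁ S₂ x a) = 0 := ha
    change normalCoord (x + t • v) = 0
    rw [hv, normalCoord_add, normalCoord_smul, normalCoord_smul, h1, h2]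
    simp
  filter_upwards [eventually_forall_mem_Icc ((tendsto_add_smul x v).eventually near₁),
    eventually_forall_mem_Icc ((tendsto_add_smul x v).eventually near₂),
    self_mem_nhdsWithin] with τ h1 h2 hτ
  obtain ⟨β₁, hβ₁, k₁⟩ := exists_control_on_segment H.b₁ H.l₁ (mem_Ioi.1 hτ).le h1
  obtain ⟨β₂, hβ₂, k₂⟩ := exists_control_on_segment H.b₂ H.l₂ (mem_Ioi.1 hτ).le h2
  refine constrainedValue_le_segment H.lam_pos H.l₁ H.l₂ H.bound₁ H.bound₂ (mem_Ioi.1 hτ).le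
    (c := fun t => (β₁ t, β₂ t, a.2.2)) (hβ₁.prodMk (hβ₂.prodMk stronglyMeasurable_const))
    (Eventually.of_forall fun t ht => ?_) (Eventually.of_forall fun t ht _ => ?_)
    (Eventually.of_forall fun t ht => ?_) (H.exists_trajectory hP _)
  · rw [globalDynamics_of_mem_hyperplane (hmem t)]
    change (a.2.2 : ℝ) • S₁.b (x + t • v) (β₁ t) + (1 - (a.2.2 : ℝ)) • S₂.b (x + t • v) (β₂ t) =
      (1 - ε) • ((a.2.2 : ℝ) • S₁.b x a.1 + (1 - (a.2.2 : ℝ)) • S₂.b x a.2.1)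
    rw [(k₁ t (Ioo_subset_Icc_self ht)).1, (k₂ t (Ioo_subset_Icc_self ht)).1]
    simp only [smul_add, smul_smul, mul_comm]
  · exact hPa _ _ (1 - ε) (sub_pos.2 hε.2) (k₁ t (Ioo_subset_Icc_self ht)).1
      (k₂ t (Ioo_subset_Icc_self ht)).1
  · rw [globalCost_of_mem_hyperplane (hmem t)]
    have e1 := (k₁ t (Ioo_subset_Icc_self ht)).2
    have e2 := (k₂ t (Ioo_subset_Icc_self ht)).2
    have m0 := a.2.2.2.1
    have m1 := sub_nonneg.2 a.2.2.2.2
    simp only [mixedCost]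
    nlinarith [mul_le_mul_of_nonneg_left e1 m0, mul_le_mul_of_nonneg_left e2 m1]

end Value

/-! ### Subsolution inequalities -/

section Value

variable [MetricSpace A₁] [CompactSpace A₁] [MetricSpace A₂] [CompactSpace A₂]
  {S₁ : ControlSystem n A₁} {S₂ : ControlSystem n A₂} {lam δ C : ℝ}
  {P : Space n → A₁ × A₂ × unitInterval → Prop}

theorem fderiv_apply_eq_inner_gradient {n : ℕ} {φ : EuclideanSpace ℝ (Fin n) → ℝ}
    (x w : EuclideanSpace ℝ (Fin n)) : fderiv ℝ φ x w = inner ℝ w (gradient φ x) := by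
  rw [real_inner_comm, gradient, InnerProductSpace.toDual_symm_apply]

theorem eventually_mem_upperHalf {x v : Space n} (hx : 0 ≤ normalCoord x)
    (h : 0 < normalCoord x ∨ 0 < normalCoord v) :
    ∀ᶠ t in 𝓝[>] (0 : ℝ), x + t • v ∈ upperHalf n := by
  rcases h with h | h
  · have ht := (tendsto_add_smul x v).mono_left (nhdsWithin_le_nhds (s := Ioi 0))
    exact ht.eventually ((isOpen_lt continuous_const continuous_normalCoord).mem_nhds h)
  · filter_upwards [self_mem_nhdsWithin] with t ht
    change 0 < normalCoord (x + t • v)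
    rw [normalCoord_add, normalCoord_smul]
    exact add_pos_of_nonneg_of_pos hx (mul_pos ht h)

theorem eventually_mem_lowerHalf {x v : Space n} (hx : normalCoord x ≤ 0)
    (h : normalCoord x < 0 ∨ normalCoord v < 0) :
    ∀ᶠ t in 𝓝[>] (0 : ℝ), x + t • v ∈ lowerHalf n := by
  rcases h with h | h
  · have ht := (tendsto_add_smul x v).mono_left (nhdsWithin_le_nhds (s := Ioi 0))
    exact ht.eventually ((isOpen_lt continuous_normalCoord continuous_const).mem_nhds h)
  · filter_upwards [self_mem_nhdsWithin] with t ht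
    change normalCoord (x + t • v) < 0
    rw [normalCoord_add, normalCoord_smul]
    exact add_neg_of_nonpos_of_neg hx (mul_neg_of_pos_of_neg ht h)

-- The second alternative, a point of the hyperplane with velocity strictly entering the half-space,
-- is what the interface condition needs.
omit [CompactSpace A₂] in
theorem StandingAssumptions.sub_upper (H : StandingAssumptions S₁ S₂ lam δ C)
    (hP : ∀ x a, IsRegularControl S₁ S₂ x a → P x a) {φ : Space n → ℝ} (hφ : ContDiff ℝ 1 φ)
    {x : Space n} (hmax : IsLocalMax (fun y => constrainedValue P S₁ S₂ lam y - φ y) x) {α : A₁}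
    (hx : 0 ≤ normalCoord x) (h : 0 < normalCoord x ∨ 0 < normalCoord (S₁.b x α)) :
    -(inner ℝ (S₁.b x α) (gradient φ x)) + lam * constrainedValue P S₁ S₂ lam x - S₁.l x α ≤ 0 := by
  have := le_add_fderiv_of_isLocalMaxOn (w := S₁.b x α) H.lam_pos
    (hφ.differentiable one_ne_zero x).hasFDerivAt (hmax.on univ)
    (Eventually.of_forall fun _ => mem_univ _)
    (fun ε hε => H.eventually_value_le_upper hP hε <| eventually_mem_upperHalf hx <|
      h.imp_right fun h => mul_pos (sub_pos.2 hε.2) h)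
  rw [fderiv_apply_eq_inner_gradient] at this
  linarith

omit [CompactSpace A₁] in
theorem StandingAssumptions.sub_lower (H : StandingAssumptions S₁ S₂ lam δ C)
    (hP : ∀ x a, IsRegularControl S₁ S₂ x a → P x a) {φ : Space n → ℝ} (hφ : ContDiff ℝ 1 φ)
    {x : Space n} (hmax : IsLocalMax (fun y => constrainedValue P S₁ S₂ lam y - φ y) x) {α : A₂}
    (hx : normalCoord x ≤ 0) (h : normalCoord x < 0 ∨ normalCoord (S₂.b x α) < 0) :
    -(inner ℝ (S₂.b x α) (gradient φ x)) + lam * constrainedValue P S₁ S₂ lam x - S₂.l x α ≤ 0 := by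
  have := le_add_fderiv_of_isLocalMaxOn (w := S₂.b x α) H.lam_pos
    (hφ.differentiable one_ne_zero x).hasFDerivAt (hmax.on univ)
    (Eventually.of_forall fun _ => mem_univ _)
    (fun ε hε => H.eventually_value_le_lower hP hε <| eventually_mem_lowerHalf hx <|
      h.imp_right fun h => mul_neg_of_pos_of_neg (sub_pos.2 hε.2) h)
  rw [fderiv_apply_eq_inner_gradient] at this
  linarith

/-- Subsolution inequality along the hyperplane. -/
theorem StandingAssumptions.sub_tangential (H : StandingAssumptions S₁ S₂ lam δ C)
    (hP : ∀ x a, IsRegularControl S₁ S₂ x a → P x a) {φ : Space n → ℝ} {x : Space n}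
    (hφ : DifferentiableAt ℝ φ x) (hx : x ∈ hyperplane n)
    (hmax : IsLocalMaxOn (fun y => constrainedValue P S₁ S₂ lam y - φ y) (hyperplane n) x)
    {a : A₁ × A₂ × unitInterval} (ha : a ∈ tangentialControls S₁ S₂ x)
    (hPa : ∀ y b (r : ℝ), 0 < r → S₁.b y b.1 = r • S₁.b x a.1 → S₂.b y b.2.1 = r • S₂.b x a.2.1 →
      P y b) :
    lam * constrainedValue P S₁ S₂ lam x ≤
      mixedCost S₁ S₂ x a + fderiv ℝ φ x (mixedDynamics S₁ S₂ x a) := by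
  refine le_add_fderiv_of_isLocalMaxOn H.lam_pos hφ.hasFDerivAt hmax
    (Eventually.of_forall fun t => ?_)
    (fun ε hε => H.eventually_value_le_tangential hP hx ha hPa hε)
  have h1 : normalCoord x = 0 := hx
  have h2 : normalCoord (mixedDynamics S₁ S₂ x a) = 0 := ha
  change normalCoord (x + t • mixedDynamics S₁ S₂ x a) = 0
  rw [normalCoord_add, normalCoord_smul, h1, h2]
  simp

omit [MetricSpace A₁] [CompactSpace A₁] [MetricSpace A₂] [CompactSpace A₂] in
theorem IsRegularControl.of_smul {x y : Space n} {a b : A₁ × A₂ × unitInterval} {r : ℝ}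
    (h : IsRegularControl S₁ S₂ x a) (hr : 0 < r) (h₁ : S₁.b y b.1 = r • S₁.b x a.1)
    (h₂ : S₂.b y b.2.1 = r • S₂.b x a.2.1) : IsRegularControl S₁ S₂ y b := by
  refine ⟨?_, ?_⟩
  · rw [h₁, normalCoord_smul]
    exact mul_nonpos_of_nonneg_of_nonpos hr.le h.1
  · rw [h₂, normalCoord_smul]
    exact mul_nonneg hr.le h.2

theorem exists_convex_combination_eq_zero {p q : ℝ} (hp : p ≤ 0) (hq : 0 ≤ q) :
    ∃ μ : unitInterval, (μ : ℝ) * p + (1 - μ) * q = 0 := by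
  rcases eq_or_ne q p with h | h
  -- Here `p ≤ 0 ≤ q` and `q = p` force both to vanish, so any weight works.
  · exact ⟨0, by simp; linarith⟩
  · have hpos : 0 < q - p := lt_of_le_of_ne (by linarith) (sub_ne_zero.2 h).symm
    refine ⟨⟨q / (q - p), div_nonneg hq hpos.le, (div_le_one hpos).2 (by linarith)⟩, ?_⟩
    field_simp
    ring

theorem StandingAssumptions.isViscositySubsolution (H : StandingAssumptions S₁ S₂ lam δ C)
    (hP : ∀ x a, IsRegularControl S₁ S₂ x a → P x a) :
    IsViscositySubsolution (hamiltonian S₁ lam) (hamiltonian S₂ lam)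
      (constrainedValue P S₁ S₂ lam) where
  bounded := ⟨C / lam, H.abs_value_le hP⟩
  usc := (H.continuous_value hP).upperSemicontinuous
  upper φ hφ x hx hmax := Real.iSup_le (fun _ =>
    H.sub_upper hP hφ hmax (le_of_lt (show 0 < normalCoord x from hx)) (Or.inl hx)) le_rfl
  lower φ hφ x hx hmax := Real.iSup_le (fun _ =>
    H.sub_lower hP hφ hmax (le_of_lt (show normalCoord x < 0 from hx)) (Or.inl hx)) le_rfl
  interface φ hφ x hx hmax := by
    by_contra! hlt
    have hx0 : normalCoord x = 0 := hx
    have : Nonempty A₁ := ⟨(H.controllable₁ x (Metric.mem_closedBall_self H.δ_pos.le)).choose⟩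
    have : Nonempty A₂ := ⟨(H.controllable₂ x (Metric.mem_closedBall_self H.δ_pos.le)).choose⟩
    obtain ⟨α₁, h₁⟩ := exists_lt_of_lt_ciSup (lt_min_iff.1 hlt).1
    obtain ⟨α₂, h₂⟩ := exists_lt_of_lt_ciSup (lt_min_iff.1 hlt).2
    rcases lt_or_ge 0 (normalCoord (S₁.b x α₁)) with k₁ | k₁
    · exact absurd (H.sub_upper hP hφ hmax hx0.ge (Or.inr k₁)) (not_le.2 h₁)
    rcases lt_or_ge (normalCoord (S₂.b x α₂)) 0 with k₂ | k₂
    · exact absurd (H.sub_lower hP hφ hmax hx0.le (Or.inr k₂)) (not_le.2 h₂)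
    -- Neither velocity enters its own half-space strictly: this is exactly regularity, so the
    -- tangential mixture is admissible for every `P`.
    obtain ⟨μ, hμ⟩ := exists_convex_combination_eq_zero k₁ k₂
    have hreg : IsRegularControl S₁ S₂ x (α₁, α₂, μ) := ⟨k₁, k₂⟩
    have key := H.sub_tangential hP (hφ.differentiable one_ne_zero x) hx (hmax.on _)
      (a := (α₁, α₂, μ)) hμ fun y b r hr e₁ e₂ => hP _ _ (hreg.of_smul hr e₁ e₂)
    rw [fderiv_apply_eq_inner_gradient] at key
    simp only [mixedCost, mixedDynamics, inner_add_left, real_inner_smul_left] at key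
    have m0 := μ.2.1
    have m1 := sub_nonneg.2 μ.2.2
    -- The convex combination of two positive quantities must be positive; the case `μ = 0` relies
    -- on `h₂` alone.
    rcases eq_or_lt_of_le m0 with h0 | h0
    · rw [← h0] at key; linarith
    · nlinarith [mul_pos h0 h₁, mul_nonneg m1 h₂.le]

/-! ### Traces on the hyperplane -/

/-- The projection `(x', x_N) ↦ x'`. -/
def tangentPart (n : ℕ) : Space n →L[ℝ] Tangent n :=
  LinearMap.toContinuousLinearMap
    { toFun := fun x => WithLp.toLp 2 fun i => x i.castSucc
      map_add' := fun _ _ => rfl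
      map_smul' := fun _ _ => rfl }

theorem tangentPart_apply (x : Space n) (i : Fin n) : tangentPart n x i = x i.castSucc := rfl

theorem tangentPart_embed (x : Tangent n) : tangentPart n (embed x) = x := by
  ext i
  simp [tangentPart_apply, embed]

theorem embed_mem_hyperplane (x : Tangent n) : embed x ∈ hyperplane n := by
  simp [hyperplane, normalCoord, embed]

theorem inner_embed (v : Space n) (p : Tangent n) :
    inner ℝ v (embed p) = inner ℝ (tangentPart n v) p := by
  simp [PiLp.inner_apply, Fin.sum_univ_castSucc, embed, tangentPart_apply]

theorem continuous_embed : Continuous (embed (n := n)) := by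
  refine (PiLp.continuous_toLp 2 _).comp (continuous_pi fun i => ?_)
  refine Fin.lastCases ?_ (fun j => ?_) i
  · simpa using continuous_const
  · simp only [Fin.snoc_castSucc]; fun_prop

theorem embed_tangentPart {x : Space n} (hx : x ∈ hyperplane n) : embed (tangentPart n x) = x := by
  ext i
  refine Fin.lastCases ?_ (fun j => ?_) i
  · have : x (Fin.last n) = 0 := hx
    simp [embed, this]
  · simp [embed, tangentPart_apply]

/-- The trace of the value on the hyperplane satisfies the tangential subsolution inequality for
every tangential control preserving the constraint. -/
theorem StandingAssumptions.sub_trace (H : StandingAssumptions S₁ S₂ lam δ C)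
    (hP : ∀ x a, IsRegularControl S₁ S₂ x a → P x a) {φ : Tangent n → ℝ} (hφ : ContDiff ℝ 1 φ)
    {x' : Tangent n}
    (hmax : IsLocalMax (fun y => constrainedValue P S₁ S₂ lam (embed y) - φ y) x')
    {a : A₁ × A₂ × unitInterval} (ha : a ∈ tangentialControls S₁ S₂ (embed x'))
    (hPa : ∀ y b (r : ℝ), 0 < r → S₁.b y b.1 = r • S₁.b (embed x') a.1 →
      S₂.b y b.2.1 = r • S₂.b (embed x') a.2.1 → P y b) :
    -(inner ℝ (mixedDynamics S₁ S₂ (embed x') a) (embed (gradient φ x'))) +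
      lam * constrainedValue P S₁ S₂ lam (embed x') - mixedCost S₁ S₂ (embed x') a ≤ 0 := by
  have hd : HasFDerivAt φ (fderiv ℝ φ x') (tangentPart n (embed x')) := by
    rw [tangentPart_embed]
    exact (hφ.differentiable one_ne_zero x').hasFDerivAt
  -- The test function is extended constantly in the normal direction. Its comparison with the value
  -- is needed only on the hyperplane, where tangential segments remain.
  have hd' := hd.comp (embed x') (tangentPart n).hasFDerivAt
  have ht : Tendsto (tangentPart n) (𝓝[hyperplane n] (embed x')) (𝓝 x') := by
    have := (tangentPart n).continuous.tendsto (embed x')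
    rw [tangentPart_embed] at this
    exact this.mono_left nhdsWithin_le_nhds
  have hmax' : IsLocalMaxOn
      (fun y => constrainedValue P S₁ S₂ lam y - (φ ∘ tangentPart n) y) (hyperplane n)
      (embed x') := by
    filter_upwards [ht.eventually hmax, self_mem_nhdsWithin] with y h1 h2
    simpa only [Function.comp, embed_tangentPart h2, tangentPart_embed] using h1
  have := H.sub_tangential hP hd'.differentiableAt (embed_mem_hyperplane x') hmax' ha hPa
  rw [hd'.fderiv, ContinuousLinearMap.comp_apply, fderiv_apply_eq_inner_gradient,
    ← inner_embed] at this
  linarith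

end Value

/-! ### Supersolution inequalities -/

/-- An almost everywhere lower bound on the derivative integrates, for Lipschitz functions. -/
theorem integral_le_sub_of_ae_hasDerivAt {g f : ℝ → ℝ} {τ : ℝ} (hτ : 0 ≤ τ)
    (hg : AbsolutelyContinuousOnInterval g 0 τ) (hf : IntegrableOn f (Ioc 0 τ))
    (h : ∀ᵐ t, t ∈ Ioc 0 τ → ∃ d, HasDerivAt g d t ∧ f t ≤ d) :
    ∫ t in Ioc 0 τ, f t ≤ g τ - g 0 := by
  rw [← hg.integral_deriv_eq_sub, intervalIntegral.integral_of_le hτ]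
  have hi := hg.intervalIntegrable_deriv
  rw [intervalIntegrable_iff_integrableOn_Ioc_of_le hτ] at hi
  refine setIntegral_mono_on_ae hf hi measurableSet_Ioc ?_
  filter_upwards [h] with t ht hmem
  obtain ⟨d, hd, hle⟩ := ht hmem
  rwa [hd.deriv]

section Value

variable [MetricSpace A₁] [MetricSpace A₂]
  {S₁ : ControlSystem n A₁} {S₂ : ControlSystem n A₂} {lam δ C : ℝ}
  {P : Space n → A₁ × A₂ × unitInterval → Prop}

/-- Pairing with the fixed vector `w = X t - x` reduces the bound to a scalar absolutely continuous
function and yields `‖w‖ * ‖w‖ ≤ ‖w‖ * C * t`. -/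
theorem IsTrajectory.norm_sub_le {x : Space n} {X : ℝ → Space n} {a : ℝ → A₁ × A₂ × unitInterval}
    (h₁ : UniformBound S₁ C) (h₂ : UniformBound S₂ C) (h : IsTrajectory S₁ S₂ x X a)
    {t : ℝ} (ht : 0 ≤ t) : ‖X t - x‖ ≤ C * t := by
  obtain ⟨K, hK⟩ := h.lipschitz
  set w := X t - x with hw
  have hac : AbsolutelyContinuousOnInterval (fun s => -inner ℝ w (X s)) 0 t := by
    refine (LipschitzOnWith.of_dist_le_mul (K := ‖w‖₊ * K)
      fun s hs r hr => ?_).absolutelyContinuousOnInterval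
    rw [uIcc_of_le ht] at hs hr
    have h1 := hK.dist_le_mul s hs.1 r hr.1
    rw [Real.dist_eq, neg_sub_neg, ← inner_sub_right]
    refine (abs_real_inner_le_norm _ _).trans ?_
    rw [norm_sub_rev (X r), ← dist_eq_norm (X s), NNReal.coe_mul, mul_assoc]
    exact mul_le_mul_of_nonneg_left h1 (norm_nonneg w)
  have hd := (ae_restrict_iff' measurableSet_Ioi).1 h.deriv_eq
  have key := integral_le_sub_of_ae_hasDerivAt (f := fun _ => -(‖w‖ * C)) ht hac
    (integrableOn_const (by simp)) (by
      filter_upwards [hd] with s hs hmem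
      refine ⟨_, ((hasDerivAt_const s w).inner ℝ (hs hmem.1)).neg, ?_⟩
      simp only [inner_zero_left, add_zero]
      refine neg_le_neg ((real_inner_le_norm _ _).trans ?_)
      gcongr
      exact norm_globalDynamics_le h₁ h₂ _ _)
  rw [setIntegral_const, h.initial] at key
  simp only [measureReal_def, Real.volume_Ioc, sub_zero, ENNReal.toReal_ofReal ht, smul_eq_mul] at key
  have e : inner ℝ w (X t) - inner ℝ w x = ‖w‖ * ‖w‖ := by
    rw [← inner_sub_right, ← hw, real_inner_self_eq_norm_mul_norm]
  rcases eq_or_lt_of_le (norm_nonneg w) with h0 | h0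
  · rw [← h0]
    exact mul_nonneg ((norm_nonneg _).trans (norm_globalDynamics_le h₁ h₂ (X 0) (a 0))) ht
  · nlinarith

theorem continuous_gradient {φ : Space n → ℝ} (hφ : ContDiff ℝ 1 φ) : Continuous (gradient φ) :=
  (InnerProductSpace.toDual ℝ (Space n)).symm.continuous.comp (hφ.continuous_fderiv one_ne_zero)

/-- A strictly negative Hamiltonian stays uniformly negative nearby, for all controls. -/
theorem eventually_forall_lt_of_hamiltonian_neg {A : Type*} [TopologicalSpace A] [CompactSpace A]
    {S : ControlSystem n A} (hb : DynamicsRegular S) (hl : CostRegular S) {φ : Space n → ℝ}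
    (hφ : ContDiff ℝ 1 φ) {x : Space n} {u : ℝ}
    (h : hamiltonian S lam x u (gradient φ x) < 0) :
    ∃ η > 0, ∀ᶠ y in 𝓝 x, ∀ α,
      -(inner ℝ (S.b y α) (gradient φ y)) + lam * (φ y + (u - φ x)) - S.l y α ≤ -η := by
  have hbc := hb.continuous
  have hlc := hl.continuous
  have hgc := continuous_gradient hφ
  have hφc := hφ.continuous
  -- The unknown value at `y` is replaced by the test function shifted to agree with `u` at `x`, so
  -- that `G` is continuous; compactness of `A` then gives one neighbourhood for all controls.
  let G : Space n × A → ℝ := fun q =>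
    -(inner ℝ (S.b q.1 q.2) (gradient φ q.1)) + lam * (φ q.1 + (u - φ x)) - S.l q.1 q.2
  have hG : Continuous G :=
    (((hbc.inner (hgc.comp continuous_fst)).neg).add
      (continuous_const.mul ((hφc.comp continuous_fst).add continuous_const))).sub hlc
  set h0 := hamiltonian S lam x u (gradient φ x) with hh0
  have hx : ∀ α, G (x, α) ≤ h0 := fun α => by
    have hbd : BddAbove (range fun α => G (x, α)) :=
      (isCompact_range (hG.comp (by fun_prop : Continuous fun α : A => (x, α)))).bddAbove
    have := le_ciSup hbd α
    simpa [G, hh0, hamiltonian] using this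
  refine ⟨-h0 / 2, by linarith, ?_⟩
  have := isCompact_univ.eventually_forall_of_forall_eventually (x₀ := x)
    (P := fun y α => G (y, α) < h0 / 2) (K := (univ : Set A)) fun α _ =>
      hG.continuousAt.eventually_lt_const (by have := hx α; linarith)
  filter_upwards [this] with y hy α
  have := (hy α (mem_univ α)).le
  simp only [G] at this
  linarith

/-- Along any trajectory near `x`, the discounted shifted test function plus the accumulated cost
grows at rate at least `η * exp (-lam * t)`. At a local minimum the value dominates the shifted test
function, so every trajectory from `x` would cost at least `u x + κ`. -/
theorem StandingAssumptions.not_isLocalMin (H : StandingAssumptions S₁ S₂ lam δ C)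
    (hP : ∀ x a, IsRegularControl S₁ S₂ x a → P x a) {φ : Space n → ℝ} (hφ : ContDiff ℝ 1 φ)
    {x : Space n} {η : ℝ} (hη : 0 < η)
    (h : ∀ᶠ y in 𝓝 x, ∀ a, -(inner ℝ (globalDynamics S₁ S₂ y a) (gradient φ y)) +
      lam * (φ y + (constrainedValue P S₁ S₂ lam x - φ x)) - globalCost S₁ S₂ y a ≤ -η) :
    ¬ IsLocalMin (fun y => constrainedValue P S₁ S₂ lam y - φ y) x := by
  intro hmin
  set u := constrainedValue P S₁ S₂ lam with hu
  have hlam := H.lam_pos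
  obtain ⟨r, hr, hball⟩ := Metric.eventually_nhds_iff_ball.1 (h.and hmin)
  obtain ⟨Y, c, hYc⟩ := H.exists_trajectory hP x
  have hC : 0 ≤ C := (norm_nonneg _).trans (norm_globalDynamics_le H.bound₁ H.bound₂ (Y 0) (c 0))
  -- At speed at most `C`, trajectories stay within `r / 2` of `x` up to this time; `C + 1` avoids
  -- dividing by zero.
  set τ := r / (2 * (C + 1)) with hτ
  have hτ0 : 0 < τ := by positivity
  have hCτ : C * τ ≤ r / 2 := by
    rw [hτ, mul_div_assoc', div_le_div_iff₀ (by positivity) (by positivity)]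
    nlinarith
  -- This is the integral of `η * exp (-lam * t)` over `[0, τ]`, the same gain for all trajectories.
  set κ := η * ((1 - Real.exp (-lam * τ)) / lam) with hκ
  have hκ0 : 0 < κ := by
    refine mul_pos hη (div_pos (sub_pos.2 (Real.exp_lt_one_iff.2 ?_)) hlam)
    nlinarith
  obtain ⟨_, ⟨X, a, hX, rfl⟩, hlt⟩ := exists_lt_of_csInf_lt (b := u x + κ)
    (s := {J | ∃ X a, IsConstrainedTrajectory P S₁ S₂ x X a ∧ J = cost S₁ S₂ lam X a})
    ⟨_, Y, c, hYc, rfl⟩ (lt_add_of_pos_right _ hκ0)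
  have hdpp := hX.le_cost hlam H.l₁ H.l₂ H.bound₁ H.bound₂ hτ0.le
  rw [← hu] at hdpp
  have hstay : ∀ t ∈ Icc 0 τ, X t ∈ Metric.closedBall x (r / 2) := fun t ht => by
    rw [mem_closedBall_iff_norm]
    refine (hX.norm_sub_le H.bound₁ H.bound₂ ht.1).trans (le_trans ?_ hCτ)
    gcongr
    exact ht.2
  have hsub : Metric.closedBall x (r / 2) ⊆ Metric.ball x r :=
    Metric.closedBall_subset_ball (half_lt_self hr)
  set k := u x - φ x with hk
  let g : ℝ → ℝ := fun t => Real.exp (-lam * t) * (φ (X t) + k)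
  have hg : AbsolutelyContinuousOnInterval g 0 τ := by
    have e1 : AbsolutelyContinuousOnInterval (fun t => Real.exp (-lam * t)) 0 τ := by
      refine ContDiffOn.absolutelyContinuousOnInterval (ContDiff.contDiffOn ?_)
      fun_prop
    have e2 : AbsolutelyContinuousOnInterval (fun t => φ (X t) + k) 0 τ := by
      obtain ⟨K, hK⟩ := hX.lipschitz
      -- A `C¹` function is Lipschitz only locally, hence the restriction to a compact convex ball
      -- containing the path.
      obtain ⟨D, hD⟩ := (hφ.contDiffOn (s := Metric.closedBall x (r / 2))).exists_lipschitzOnWith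
        one_ne_zero (convex_closedBall _ _) (isCompact_closedBall _ _)
      have hcomp := hD.comp (hK.mono (Icc_subset_Ici_self : Icc 0 τ ⊆ Ici 0)) hstay
      refine LipschitzOnWith.absolutelyContinuousOnInterval (K := D * K)
        (LipschitzOnWith.of_dist_le_mul fun s hs t ht => ?_)
      rw [uIcc_of_le hτ0.le] at hs ht
      simpa using hcomp.dist_le_mul s hs t ht
    exact e1.mul e2
  have hcost := (hX.integrableOn_cost hlam H.l₁ H.l₂ H.bound₁ H.bound₂).mono_set
    (Ioc_subset_Ioi_self : Ioc 0 τ ⊆ Ioi 0)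
  have hexp := ((integrableOn_exp_discount hlam 0).mono_set
    (Ioc_subset_Ioi_self : Ioc 0 τ ⊆ Ioi 0)).const_mul η
  have hd := (ae_restrict_iff' measurableSet_Ioi).1 hX.deriv_eq
  have key := integral_le_sub_of_ae_hasDerivAt (g := g) hτ0.le hg (hexp.sub hcost) (by
    filter_upwards [hd] with t ht hmem
    have hXd := ht hmem.1
    have e1 : HasDerivAt (fun t => Real.exp (-lam * t)) (Real.exp (-lam * t) * -lam) t := by
      simpa using ((hasDerivAt_id t).const_mul (-lam)).exp
    have e2 := ((hφ.differentiable one_ne_zero (X t)).hasFDerivAt.comp_hasDerivAt t hXd).add_const k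
    refine ⟨_, e1.mul e2, ?_⟩
    have hloc := (hball (X t) (hsub (hstay t ⟨hmem.1.le, hmem.2⟩))).1 (a t)
    rw [fderiv_apply_eq_inner_gradient]
    simp only [Pi.sub_apply]
    have hpos := Real.exp_pos (-lam * t)
    nlinarith [mul_le_mul_of_nonneg_left hloc hpos.le])
  rw [integral_sub' hexp hcost, integral_const_mul, setIntegral_exp_discount hlam hτ0.le] at key
  have hend : φ (X τ) + k ≤ u (X τ) := by
    have := (hball (X τ) (hsub (hstay τ ⟨hτ0.le, le_rfl⟩))).2
    rw [hk]
    linarith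
  have hg0 : g 0 = u x := by simp [g, hX.initial, hk]
  have hgτ : g τ ≤ Real.exp (-lam * τ) * u (X τ) :=
    mul_le_mul_of_nonneg_left hend (Real.exp_pos _).le
  linarith

variable [CompactSpace A₁] [CompactSpace A₂]

theorem StandingAssumptions.isViscositySupersolution (H : StandingAssumptions S₁ S₂ lam δ C)
    (hP : ∀ x a, IsRegularControl S₁ S₂ x a → P x a) :
    IsViscositySupersolution (hamiltonian S₁ lam) (hamiltonian S₂ lam)
      (constrainedValue P S₁ S₂ lam) where
  bounded := ⟨C / lam, H.abs_value_le hP⟩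
  lsc := (H.continuous_value hP).lowerSemicontinuous
  upper φ hφ x hx hmin := by
    by_contra! hlt
    obtain ⟨η, hη, h⟩ := eventually_forall_lt_of_hamiltonian_neg H.b₁ H.l₁ hφ hlt
    refine H.not_isLocalMin hP hφ hη ?_ hmin
    filter_upwards [h, (isOpen_lt continuous_const continuous_normalCoord).mem_nhds hx]
      with y h1 (h2 : y ∈ upperHalf n) a
    rw [globalDynamics_of_mem_upperHalf h2, globalCost_of_mem_upperHalf h2]
    exact h1 a.1
  lower φ hφ x hx hmin := by
    by_contra! hlt
    obtain ⟨η, hη, h⟩ := eventually_forall_lt_of_hamiltonian_neg H.b₂ H.l₂ hφ hlt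
    refine H.not_isLocalMin hP hφ hη ?_ hmin
    filter_upwards [h, (isOpen_lt continuous_normalCoord continuous_const).mem_nhds hx]
      with y h1 (h2 : y ∈ lowerHalf n) a
    rw [globalDynamics_of_mem_lowerHalf h2, globalCost_of_mem_lowerHalf h2]
    exact h1 a.2.1
  interface φ hφ x _ hmin := by
    by_contra! hlt
    obtain ⟨η₁, hη₁, h₁⟩ :=
      eventually_forall_lt_of_hamiltonian_neg H.b₁ H.l₁ hφ (max_lt_iff.1 hlt).1
    obtain ⟨η₂, hη₂, h₂⟩ :=
      eventually_forall_lt_of_hamiltonian_neg H.b₂ H.l₂ hφ (max_lt_iff.1 hlt).2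
    refine H.not_isLocalMin hP hφ (lt_min hη₁ hη₂) ?_ hmin
    filter_upwards [h₁, h₂] with y k₁ k₂ a
    have e₁ := (k₁ a.1).trans (neg_le_neg (min_le_left η₁ η₂))
    have e₂ := (k₂ a.2.1).trans (neg_le_neg (min_le_right η₁ η₂))
    unfold globalDynamics globalCost
    split_ifs
    · exact e₁
    · exact e₂
    -- On the hyperplane the expression is affine in the mixing weight, so it interpolates the two
    -- bounds.
    · have m0 := a.2.2.2.1
      have m1 := sub_nonneg.2 a.2.2.2.2
      simp only [mixedDynamics, mixedCost, inner_add_left, real_inner_smul_left]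
      nlinarith [mul_le_mul_of_nonneg_left e₁ m0, mul_le_mul_of_nonneg_left e₂ m1]

theorem StandingAssumptions.isViscositySolution (H : StandingAssumptions S₁ S₂ lam δ C)
    (hP : ∀ x a, IsRegularControl S₁ S₂ x a → P x a) :
    IsViscositySolution (hamiltonian S₁ lam) (hamiltonian S₂ lam)
      (constrainedValue P S₁ S₂ lam) :=
  ⟨H.isViscositySubsolution hP, H.isViscositySupersolution hP⟩

end Value

end TwoDomain

end

/-! ### The two value functions -/

theorem theorem2p4 {n : ℕ} {A₁ A₂ : Type*}
    [MetricSpace A₁] [CompactSpace A₁] [MetricSpace A₂] [CompactSpace A₂]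
    (S₁ : TwoDomain.ControlSystem n A₁) (S₂ : TwoDomain.ControlSystem n A₂)
    (lam : ℝ) (hlam : 0 < lam)
    (hb₁ : TwoDomain.DynamicsRegular S₁) (hb₂ : TwoDomain.DynamicsRegular S₂)
    (hl₁ : TwoDomain.CostRegular S₁) (hl₂ : TwoDomain.CostRegular S₂)
    (hc₁ : TwoDomain.ClosedConvexImages S₁) (hc₂ : TwoDomain.ClosedConvexImages S₂)
    (hδ : ∃ δ : ℝ, 0 < δ ∧ TwoDomain.Controllable S₁ δ ∧ TwoDomain.Controllable S₂ δ) :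
    TwoDomain.IsViscositySolution
        (TwoDomain.hamiltonian S₁ lam) (TwoDomain.hamiltonian S₂ lam)
        (TwoDomain.valueMinus S₁ S₂ lam) ∧
      TwoDomain.IsViscositySolution
        (TwoDomain.hamiltonian S₁ lam) (TwoDomain.hamiltonian S₂ lam)
        (TwoDomain.valuePlus S₁ S₂ lam) ∧
      TwoDomain.IsTangentialSubsolution
        (TwoDomain.tangentialHamiltonian S₁ S₂ lam)
        (fun x' => TwoDomain.valueMinus S₁ S₂ lam (TwoDomain.embed x')) ∧
      TwoDomain.IsTangentialSubsolution
        (TwoDomain.regularTangentialHamiltonian S₁ S₂ lam)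
        (fun x' => TwoDomain.valuePlus S₁ S₂ lam (TwoDomain.embed x')) := by
  obtain ⟨δ, hδ0, hδ₁, hδ₂⟩ := hδ
  obtain ⟨C₁, hC₁⟩ := TwoDomain.exists_uniformBound hb₁ hl₁
  obtain ⟨C₂, hC₂⟩ := TwoDomain.exists_uniformBound hb₂ hl₂
  have H : TwoDomain.StandingAssumptions S₁ S₂ lam δ (max C₁ C₂) :=
    ⟨hlam, hb₁, hb₂, hl₁, hl₂, hc₁, hc₂, hδ0, hδ₁, hδ₂, hC₁.mono (le_max_left _ _),
      hC₂.mono (le_max_right _ _)⟩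
  rw [TwoDomain.valueMinus_eq, TwoDomain.valuePlus_eq]
  have hT : ∀ x a, TwoDomain.IsRegularControl S₁ S₂ x a → (fun _ _ => True) x a :=
    fun _ _ _ => trivial
  have hR : ∀ x a, TwoDomain.IsRegularControl S₁ S₂ x a → TwoDomain.IsRegularControl S₁ S₂ x a :=
    fun _ _ h => h
  refine ⟨H.isViscositySolution hT, H.isViscositySolution hR, ⟨⟨_, fun x' => H.abs_value_le hT _⟩,
    ((H.continuous_value hT).comp TwoDomain.continuous_embed).upperSemicontinuous,
    fun φ hφ x' hmax => ?_⟩, ⟨⟨_, fun x' => H.abs_value_le hR _⟩,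
    ((H.continuous_value hR).comp TwoDomain.continuous_embed).upperSemicontinuous,
    fun φ hφ x' hmax => ?_⟩⟩
  -- The bound `0` is itself nonnegative, so `Real.iSup_le` requires no nonemptiness of the set of
  -- tangential controls.
  · exact Real.iSup_le (fun a => H.sub_trace hT hφ hmax a.2 fun _ _ _ _ _ _ => trivial) le_rfl
  · exact Real.iSup_le (fun a => H.sub_trace hR hφ hmax a.2.1
      fun _ _ _ hr e₁ e₂ => a.2.2.of_smul hr e₁ e₂) le_rfl
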